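/- Let $K\ge 3$. Consider an exponential family of distributions on a measurable space $\mathcal X$ with densities $f(x|\eta)=h(x)\exp(\eta^{T}\mathbf T(x)-A(\eta))$ with respect to a reference measure $\nu$, where $\mathbf T:\mathcal X\to\mathbb R^d$ and $A(\eta)=\log\int h(x)e^{\eta^T\mathbf T(x)}\,\nu(dx)$ is finite and twice continuously differentiable on the open convex parameter set $\Theta\subseteq\mathbb R^d$, and distinct $\eta\in\Theta$ give distinct distributions. Write $\kappa(\eta)=E_\eta[\mathbf T]$, $\eta(\cdot)$ for the inverse of $\kappa(\cdot)$ on $\kappa(\Theta)$, and $D(\cdot\|\cdot)$ for the relative entropy between members of the family. There are $K$ arms; in the configuration $\psi=(i,\eta_1,\eta_2)$, with $\eta_1\neq\eta_2$ in $\Theta$, observations from arm $i$ have density $f(\cdot|\eta_1)$ and observations from every other arm have density $f(\cdot|\eta_2)$. In round $t\geq 1$ one arm $A_t$ is pulled and $X_t$ is observed; given the past and $A_t$, $X_t$ has the distribution of arm $A_t$. For $k\in\{1,\dots,K\}$ and $\eta_1\ne\eta_2$ in $\Theta$ let $\lambda^*(k,\eta_1,\eta_2)$ be a probability vector $\lambda$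 on the arms maximising $$\min_{\eta_1',\eta_2'\in\Theta,\ j\ne k}\bigl[\lambda(k)D(\eta_1\|\eta_2')+\lambda(j)D(\eta_2\|\eta_1')+(1-\lambda(k)-\lambda(j))D(\eta_2\|\eta_2')\bigr]$$ (the minimum is understood as an infimum), and assume that there is $c_K\in(0,1)$ with $\lambda^*(k,\eta_1,\eta_2)(j)\ge c_K$ for all $j$, $k$ and all $\eta_1\neq\eta_2$ in $\Theta$. Let $N_j^n=\sum_{t\le n}1_{\{A_t=j\}}$, $\mathbf Y_j^n=\sum_{t\le n}\mathbf T(X_t)1_{\{A_t=j\}}$, $\mathbf Y^n=\sum_j\mathbf Y_j^n$, and let $$f(X^n,A^n|j,\theta_1,\theta_2)=\Bigl(\prod_{t\le n}h(X_t)\Bigr)\exp\{\theta_1^T\mathbf Y_j^n-N_j^nA(\theta_1)\}\exp\{\theta_2^T(\mathbf Y^n-\mathbf Y_j^n)-(n-N_j^n)A(\theta_2)\}$$ be the likelihood. Fix hyper-parameters $\tau\in\mathbb R^d$, $n_0\in\mathbb R$ with $\int_\Theta e^{\tau^T\theta-n_0A(\theta)}d\theta<\infty$, and let $$Z_{kj}(n)=\log\frac{\tilde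 f_k(n)}{\hat f_j(n)},\qquad Z_k(n)=\min_{j\ne k}Z_{kj}(n),$$ where $\hat f_j(n)=\sup_{\theta_1,\theta_2\in\Theta}f(X^n,A^n|j,\theta_1,\theta_2)$, and $\tilde f_k(n)$ is the average of $f(X^n,A^n|k,\theta_1,\theta_2)$ when $\theta_1,\theta_2$ are independent with density on $\Theta$ proportional to $e^{\tau^T\theta-n_0A(\theta)}$ ($Z_{kj}(n)=-\infty$ if $\hat f_j(n)=\infty$). The policy $\pi_{SM}(L,\gamma)$, with $0<\gamma\le1$, pulls an arbitrary first arm $A_1$. At time $n\ge1$ it lets $i^*(n)$ be an arm maximising $Z_k(n)$, ties being resolved uniformly at random. If $Z_{i^*(n)}(n)\ge\log((K-1)L)$, it stops and declares $i^*(n)$. Otherwise it tosses a Bernoulli($\gamma$) coin $U_{n+1}$, independent of everything before. If $U_{n+1}=0$, then $A_{n+1}=A_n$. If $U_{n+1}=1$, then $A_{n+1}$ is drawn from $\lambda^*(k,\hat\eta_1,\hat\eta_2)$ with $k=i^*(n)$, $\hat\eta_1=\eta(\mathbf Y_k^n/N_k^n)$ and $\hat\eta_2=\eta((\mathbf Y^n-\mathbf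 Y_k^n)/(n-N_k^n))$; if these estimates are not defined or coincide, $A_{n+1}$ is drawn from a fixed distribution giving positive probability to every arm. The policy $\tilde\pi_{SM}$ is the same except that it never stops. Let $\tau(\pi)$ denote the time at which a policy $\pi$ stops. Then, for every configuration $\psi=(i,\eta_1,\eta_2)$ with $\eta_1\ne\eta_2$: (1) for every $L>1$, the policy $\pi_{SM}(L,\gamma)$ stops in finite time with probability one: $P(\tau(\pi_{SM}(L,\gamma))<\infty)=1$; (2) under $\tilde\pi_{SM}$, almost surely $\liminf_{n\to\infty}Z_{ij}(n)/n>0$ for every $j\ne i$. -/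

import Mathlib

open MeasureTheory ProbabilityTheory Filter
open scoped ENNReal BigOperators RealInnerProductSpace

noncomputable section

/-- A vector exponential family with densities `h(x) exp(ηᵀ T(x) - A(η))` with respect to a
reference measure `ν` (Lebesgue measure for densities, counting measure for mass functions), with
canonical parameter `η` ranging over an open convex set `Θ` of `ℝᵈ` on which `A` is finite. -/
structure ExpFamily (𝒳 : Type*) [MeasurableSpace 𝒳] (d : ℕ) where
  /-- reference measure -/
  ν : Measure 𝒳
  /-- carrier function -/
  h : 𝒳 → ℝ
  /-- sufficient statistic -/
  T : 𝒳 → EuclideanSpace ℝ (Fin d)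
  /-- set of canonical parameters -/
  Θ : Set (EuclideanSpace ℝ (Fin d))
  h_nonneg : ∀ x, 0 ≤ h x
  measurable_h : Measurable h
  measurable_T : Measurable T
  isOpen_Θ : IsOpen Θ
  convex_Θ : Convex ℝ Θ
  integrable_weight : ∀ η ∈ Θ, Integrable (fun x => h x * Real.exp ⟪η, T x⟫) ν
  integral_weight_pos : ∀ η ∈ Θ, 0 < ∫ x, h x * Real.exp ⟪η, T x⟫ ∂ν

namespace ExpFamily

variable {𝒳 : Type*} [MeasurableSpace 𝒳] {d : ℕ} (fam : ExpFamily 𝒳 d)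

/-- The log partition function `A(η) = log ∫ h(x) exp(ηᵀ T(x)) dν(x)`. -/
def logPartition (η : EuclideanSpace ℝ (Fin d)) : ℝ :=
  Real.log (∫ x, fam.h x * Real.exp ⟪η, fam.T x⟫ ∂fam.ν)

/-- The density `f(x|η) = h(x) exp(ηᵀ T(x) - A(η))`. -/
def density (η : EuclideanSpace ℝ (Fin d)) (x : 𝒳) : ℝ :=
  fam.h x * Real.exp (⟪η, fam.T x⟫ - fam.logPartition η)

/-- The distribution with density `f(·|η)`. -/
def law (η : EuclideanSpace ℝ (Fin d)) : Measure 𝒳 :=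
  fam.ν.withDensity (fun x => ENNReal.ofReal (fam.density η x))

/-- Regularity of the family: the log partition function is twice continuously differentiable on
`Θ`, and distinct canonical parameters give distinct distributions. -/
structure IsRegular : Prop where
  contDiffOn_logPartition : ContDiffOn ℝ 2 fam.logPartition fam.Θ
  identifiable : Set.InjOn fam.law fam.Θ

/-- The expectation parameter `κ(η) = E_η[T(X)]`. -/
def meanParam (η : EuclideanSpace ℝ (Fin d)) : EuclideanSpace ℝ (Fin d) :=
  ∫ x, fam.T x ∂(fam.law η)

/-- The canonical parameter `η(κ) ∈ Θ` dual to an expectation parameter `κ ∈ κ(Θ)`: the inverse of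
`η ↦ κ(η)`. Only used at points of `κ(Θ)`. -/
def canonicalParam (κ : EuclideanSpace ℝ (Fin d)) : EuclideanSpace ℝ (Fin d) :=
  Function.invFunOn fam.meanParam fam.Θ κ

/-- Relative entropy `D(η ‖ η')` between the members with parameters `η` and `η'`. -/
def relEntropy (η η' : EuclideanSpace ℝ (Fin d)) : ℝ≥0∞ :=
  InformationTheory.klDiv (fam.law η) (fam.law η')

/-- The inner minimum in the definition of `D*(i, η₁, η₂)`: the smallest rate, over the alternatives
`(j, η₁', η₂')` with `j ≠ i`, at which the sampling distribution `w` discriminates. -/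
def discrimination {K : ℕ} (i : Fin K) (η₁ η₂ : EuclideanSpace ℝ (Fin d)) (w : Fin K → ℝ) : ℝ≥0∞ :=
  ⨅ (j : Fin K) (_ : j ≠ i) (η₁' ∈ fam.Θ) (η₂' ∈ fam.Θ),
    (ENNReal.ofReal (w i) * fam.relEntropy η₁ η₂'
      + ENNReal.ofReal (w j) * fam.relEntropy η₂ η₁'
      + ENNReal.ofReal (1 - w i - w j) * fam.relEntropy η₂ η₂')

/-- `w` is a probability vector attaining the maximum
`D*(i, η₁, η₂) = max_w min_{η₁', η₂', j ≠ i} [...]`. -/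
def IsOptimalSampling {K : ℕ} (i : Fin K) (η₁ η₂ : EuclideanSpace ℝ (Fin d))
    (w : Fin K → ℝ) : Prop :=
  w ∈ stdSimplex ℝ (Fin K) ∧
    IsMaxOn (fam.discrimination i η₁ η₂) (stdSimplex ℝ (Fin K)) w

/-! ### Statistics of a sequence of arms `a 1, a 2, …` and observations `x 1, x 2, …` -/

/-- `N_j^n`: the number of pulls of arm `j` up to time `n`. -/
def pulls {K : ℕ} (a : ℕ → Fin K) (j : Fin K) (n : ℕ) : ℕ :=
  ((Finset.Icc 1 n).filter (fun t => a t = j)).card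

/-- `Y_j^n`: the sum of the sufficient statistic over the pulls of arm `j` up to time `n`. -/
def armSum {K : ℕ} (a : ℕ → Fin K) (x : ℕ → 𝒳) (j : Fin K) (n : ℕ) :
    EuclideanSpace ℝ (Fin d) :=
  ∑ t ∈ Finset.Icc 1 n, if a t = j then fam.T (x t) else 0

/-- `Y^n = ∑_j Y_j^n`. -/
def totalSum {K : ℕ} (a : ℕ → Fin K) (x : ℕ → 𝒳) (n : ℕ) : EuclideanSpace ℝ (Fin d) :=
  ∑ j, fam.armSum a x j n

/-- The likelihood `f(Xⁿ, Aⁿ | ψ = (j, η₁, η₂))` of the first `n` rounds. -/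
def likelihood {K : ℕ} (a : ℕ → Fin K) (x : ℕ → 𝒳) (n : ℕ) (j : Fin K)
    (η₁ η₂ : EuclideanSpace ℝ (Fin d)) : ℝ≥0∞ :=
  ENNReal.ofReal ((∏ t ∈ Finset.Icc 1 n, fam.h (x t))
    * Real.exp (⟪η₁, fam.armSum a x j n⟫ - (pulls a j n : ℝ) * fam.logPartition η₁)
    * Real.exp (⟪η₂, fam.totalSum a x n - fam.armSum a x j n⟫
        - ((n : ℝ) - (pulls a j n : ℝ)) * fam.logPartition η₂))

/-- The maximum likelihood under `H = j` (a supremum, as it need not be attained when there are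
few observations; it may then be infinite). -/
def maxLikelihood {K : ℕ} (a : ℕ → Fin K) (x : ℕ → 𝒳) (n : ℕ) (j : Fin K) : ℝ≥0∞ :=
  ⨆ (η₁ ∈ fam.Θ) (η₂ ∈ fam.Θ), fam.likelihood a x n j η₁ η₂

/-- The unnormalised conjugate prior density `exp(τᵀ η - n₀ A(η))`. -/
def priorWeight (τ : EuclideanSpace ℝ (Fin d)) (n₀ : ℝ) (η : EuclideanSpace ℝ (Fin d)) : ℝ≥0∞ :=
  ENNReal.ofReal (Real.exp (⟪τ, η⟫ - n₀ * fam.logPartition η))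

/-- The normalising factor `𝓗(τ, n₀) = [∫_Θ exp(τᵀ η - n₀ A(η)) dη]⁻¹`. -/
def priorNorm (τ : EuclideanSpace ℝ (Fin d)) (n₀ : ℝ) : ℝ≥0∞ :=
  (∫⁻ η in fam.Θ, fam.priorWeight τ n₀ η)⁻¹

/-- The conjugate prior density `f(η | τ, n₀)`. -/
def priorDensity (τ : EuclideanSpace ℝ (Fin d)) (n₀ : ℝ) (η : EuclideanSpace ℝ (Fin d)) : ℝ≥0∞ :=
  fam.priorNorm τ n₀ * fam.priorWeight τ n₀ η

/-- The likelihood under `H = i` averaged over the product prior. -/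
def avgLikelihood {K : ℕ} (τ : EuclideanSpace ℝ (Fin d)) (n₀ : ℝ) (a : ℕ → Fin K) (x : ℕ → 𝒳)
    (n : ℕ) (i : Fin K) : ℝ≥0∞ :=
  ∫⁻ η₁ in fam.Θ, ∫⁻ η₂ in fam.Θ,
    fam.likelihood a x n i η₁ η₂ * fam.priorDensity τ n₀ η₁ * fam.priorDensity τ n₀ η₂

/-- The modified generalised log-likelihood ratio `Z_{ij}(n)` (it is `-∞` when the maximum
likelihood in the denominator is infinite). -/
def glr {K : ℕ} (τ : EuclideanSpace ℝ (Fin d)) (n₀ : ℝ) (a : ℕ → Fin K) (x : ℕ → 𝒳)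
    (i j : Fin K) (n : ℕ) : EReal :=
  ENNReal.log (fam.avgLikelihood τ n₀ a x n i / fam.maxLikelihood a x n j)

/-- `Z_i(n) = min_{j ≠ i} Z_{ij}(n)`. -/
def minGlr {K : ℕ} (τ : EuclideanSpace ℝ (Fin d)) (n₀ : ℝ) (a : ℕ → Fin K) (x : ℕ → 𝒳)
    (i : Fin K) (n : ℕ) : EReal :=
  ⨅ (j : Fin K) (_ : j ≠ i), fam.glr τ n₀ a x i j n

open Classical in
/-- The arms with the largest modified GLR at time `n`. -/
def leaders {K : ℕ} (τ : EuclideanSpace ℝ (Fin d)) (n₀ : ℝ) (a : ℕ → Fin K) (x : ℕ → 𝒳)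
    (n : ℕ) : Finset (Fin K) :=
  Finset.univ.filter (fun k => ∀ l, fam.minGlr τ n₀ a x l n ≤ fam.minGlr τ n₀ a x k n)

/-- `Y_j^n / N_j^n`, the estimate of the expectation parameter of the odd arm under `H = j`. -/
def oddMean {K : ℕ} (a : ℕ → Fin K) (x : ℕ → 𝒳) (j : Fin K) (n : ℕ) :
    EuclideanSpace ℝ (Fin d) :=
  (pulls a j n : ℝ)⁻¹ • fam.armSum a x j n

/-- `(Y^n - Y_j^n) / (n - N_j^n)`, the estimate of the expectation parameter of the other arms
under `H = j`. -/
def restMean {K : ℕ} (a : ℕ → Fin K) (x : ℕ → 𝒳) (j : Fin K) (n : ℕ) :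
    EuclideanSpace ℝ (Fin d) :=
  ((n : ℝ) - (pulls a j n : ℝ))⁻¹ • (fam.totalSum a x n - fam.armSum a x j n)

/-- The maximum likelihood estimates of both canonical parameters under `H = j` at time `n` are
defined (no division by zero, both means are expectation parameters of the family), and they are
different, as for every configuration of the problem. -/
def EstimatesDefined {K : ℕ} (a : ℕ → Fin K) (x : ℕ → 𝒳) (j : Fin K) (n : ℕ) : Prop :=
  0 < pulls a j n ∧ pulls a j n < n ∧
    fam.oddMean a x j n ∈ fam.meanParam '' fam.Θ ∧
    fam.restMean a x j n ∈ fam.meanParam '' fam.Θ ∧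
    fam.canonicalParam (fam.oddMean a x j n) ≠ fam.canonicalParam (fam.restMean a x j n)

end ExpFamily

/-- The data of the sluggish modified GLR policy: hyper-parameters of the conjugate prior, switching
parameter, sampling distributions `λ*(k, η₁, η₂)`, and the distribution used for sampling as long
as the parameter estimates are undefined or coincide. -/
structure SluggishPolicy (K d : ℕ) where
  /-- first hyper-parameter of the conjugate prior -/
  τ : EuclideanSpace ℝ (Fin d)
  /-- second hyper-parameter of the conjugate prior -/
  n₀ : ℝ
  /-- switching parameter -/
  γ : ℝ
  /-- the sampling distributions `λ*(k, η₁, η₂)` -/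
  lamStar : Fin K → EuclideanSpace ℝ (Fin d) → EuclideanSpace ℝ (Fin d) → Fin K → ℝ
  /-- sampling distribution in the absence of estimates -/
  fallback : Fin K → ℝ

namespace SluggishPolicy

variable {𝒳 : Type*} [MeasurableSpace 𝒳] {K d : ℕ}

/-- The data are those of a sluggish modified GLR policy for the family: proper prior, `0 < γ ≤ 1`,
`λ*` attains the maximum in `D*`, and the fallback distribution charges every arm. -/
structure IsValid (pol : SluggishPolicy K d) (fam : ExpFamily 𝒳 d) : Prop where
  proper_prior : ∫⁻ η in fam.Θ, fam.priorWeight pol.τ pol.n₀ η < ∞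
  γ_pos : 0 < pol.γ
  γ_le_one : pol.γ ≤ 1
  lamStar_optimal : ∀ (k : Fin K), ∀ η₁ ∈ fam.Θ, ∀ η₂ ∈ fam.Θ, η₁ ≠ η₂ →
    fam.IsOptimalSampling k η₁ η₂ (pol.lamStar k η₁ η₂)
  fallback_mem : pol.fallback ∈ stdSimplex ℝ (Fin K)
  fallback_pos : ∀ j, 0 < pol.fallback j

/-- Nontrivial sampling of all arms: `λ*(k, η₁, η₂)(j) ≥ c > 0` with `c` independent of
`(k, η₁, η₂)` and `j`. -/
def SamplesAllArms (pol : SluggishPolicy K d) (fam : ExpFamily 𝒳 d) : Prop :=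
  ∃ c : ℝ, 0 < c ∧ c < 1 ∧ ∀ (k : Fin K), ∀ η₁ ∈ fam.Θ, ∀ η₂ ∈ fam.Θ, η₁ ≠ η₂ →
    ∀ j, c ≤ pol.lamStar k η₁ η₂ j

open Classical in
/-- The distribution from which the next arm is drawn after a successful coin toss at time `n`, when
`k` is the current leader. -/
def samplingDist (pol : SluggishPolicy K d) (fam : ExpFamily 𝒳 d) (a : ℕ → Fin K) (x : ℕ → 𝒳)
    (k : Fin K) (n : ℕ) : Fin K → ℝ :=
  if fam.EstimatesDefined a x k n then
    pol.lamStar k (fam.canonicalParam (fam.oddMean a x k n))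
      (fam.canonicalParam (fam.restMean a x k n))
  else pol.fallback

end SluggishPolicy

/-- The parameter of arm `k` in the configuration `(i, η₁, η₂)`. -/
def armParam {K d : ℕ} (i : Fin K) (η₁ η₂ : EuclideanSpace ℝ (Fin d)) (k : Fin K) :
    EuclideanSpace ℝ (Fin d) :=
  if k = i then η₁ else η₂

/-- The σ-algebra generated by `A_1,…,A_p`, `X_1,…,X_q`, `I_1,…,I_r` and `U_2,…,U_s`. -/
@[reducible] def infoSigma {Ω 𝒳 : Type*} [MeasurableSpace 𝒳] {K : ℕ}
    (A : ℕ → Ω → Fin K) (X : ℕ → Ω → 𝒳) (I : ℕ → Ω → Fin K) (U : ℕ → Ω → Bool)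
    (p q r s : ℕ) : MeasurableSpace Ω :=
  (⨆ t ∈ Finset.Icc 1 p, MeasurableSpace.comap (A t) inferInstance)
    ⊔ (⨆ t ∈ Finset.Icc 1 q, MeasurableSpace.comap (X t) inferInstance)
    ⊔ (⨆ t ∈ Finset.Icc 1 r, MeasurableSpace.comap (I t) inferInstance)
    ⊔ (⨆ t ∈ Finset.Icc 2 s, MeasurableSpace.comap (U t) inferInstance)

/-- The statistic `Z_{I_n}(n)` of the leader `I_n` at time `n`. -/
def leaderStat {Ω 𝒳 : Type*} [MeasurableSpace 𝒳] {K d : ℕ}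
    (fam : ExpFamily 𝒳 d) (pol : SluggishPolicy K d)
    (A : ℕ → Ω → Fin K) (X : ℕ → Ω → 𝒳) (I : ℕ → Ω → Fin K) (n : ℕ) (ω : Ω) : EReal :=
  fam.minGlr pol.τ pol.n₀ (fun t => A t ω) (fun t => X t ω) (I n ω) n

/-- The policy has not stopped at any of the times `1, …, n`, when it stops as soon as the statistic
of the leader satisfies `halt`. -/
def IsActive {Ω 𝒳 : Type*} [MeasurableSpace 𝒳] {K d : ℕ}
    (fam : ExpFamily 𝒳 d) (pol : SluggishPolicy K d) (halt : EReal → Prop)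
    (A : ℕ → Ω → Fin K) (X : ℕ → Ω → 𝒳) (I : ℕ → Ω → Fin K) (n : ℕ) (ω : Ω) : Prop :=
  ∀ m, 1 ≤ m → m ≤ n → ¬ halt (leaderStat fam pol A X I m ω)

/-- The stopping time `inf {n ≥ 1 : the policy stops at time n}`. -/
def stoppingTime {Ω 𝒳 : Type*} [MeasurableSpace 𝒳] {K d : ℕ}
    (fam : ExpFamily 𝒳 d) (pol : SluggishPolicy K d) (halt : EReal → Prop)
    (A : ℕ → Ω → Fin K) (X : ℕ → Ω → 𝒳) (I : ℕ → Ω → Fin K) (ω : Ω) : ℕ∞ :=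
  ⨅ (n : ℕ) (_ : 1 ≤ n) (_ : halt (leaderStat fam pol A X I n ω)), (n : ℕ∞)

/-- The stopping rule of the policy with threshold `L`: stop when the statistic of the leader is at
least `log((K - 1) L)`. -/
def thresholdStop (K : ℕ) (L : ℝ) (z : EReal) : Prop :=
  ((Real.log (((K : ℝ) - 1) * L) : ℝ) : EReal) ≤ z

/-- The stopping rule of the non-stopping variant. -/
def neverStop (_ : EReal) : Prop := False

open Classical in
/-- `A` (arms pulled), `X` (observations), `I` (leaders) and `U` (coins) form a run of the policy
under the configuration `(i, η₁, η₂)`. As long as the policy has not stopped,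
* the observation `X_n` from arm `A_n` has the distribution of that arm;
* the leader `I_n` is uniform on the set of arms with the largest modified GLR;
* the coin `U_{n+1}` is Bernoulli(`γ`), independent of everything before;
* `A_{n+1} = A_n` if the coin fails, and `A_{n+1}` is drawn from the current sampling distribution
  if it succeeds.
The first arm `A_1` is arbitrary, and nothing is required after stopping. -/
structure IsRun {Ω 𝒳 : Type*} [MeasurableSpace Ω] [MeasurableSpace 𝒳] {K d : ℕ}
    (P : Measure Ω) (fam : ExpFamily 𝒳 d) (pol : SluggishPolicy K d) (halt : EReal → Prop)
    (i : Fin K) (η₁ η₂ : EuclideanSpace ℝ (Fin d))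
    (A : ℕ → Ω → Fin K) (X : ℕ → Ω → 𝒳) (I : ℕ → Ω → Fin K) (U : ℕ → Ω → Bool) : Prop where
  measurable_A : ∀ n, Measurable (A n)
  measurable_X : ∀ n, Measurable (X n)
  measurable_I : ∀ n, Measurable (I n)
  measurable_U : ∀ n, Measurable (U n)
  observation : ∀ n, 1 ≤ n → ∀ B : Set 𝒳, MeasurableSet B →
    ∀ᵐ ω ∂P, IsActive fam pol halt A X I (n - 1) ω →
      (P⟦X n ⁻¹' B | infoSigma A X I U n (n - 1) (n - 1) n⟧) ω
        = (fam.law (armParam i η₁ η₂ (A n ω))).real B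
  leader : ∀ n, 1 ≤ n → ∀ k : Fin K,
    ∀ᵐ ω ∂P, IsActive fam pol halt A X I (n - 1) ω →
      (P⟦I n ⁻¹' {k} | infoSigma A X I U n n (n - 1) n⟧) ω
        = if k ∈ fam.leaders pol.τ pol.n₀ (fun t => A t ω) (fun t => X t ω) n then
            ((fam.leaders pol.τ pol.n₀ (fun t => A t ω) (fun t => X t ω) n).card : ℝ)⁻¹
          else 0
  coin : ∀ n, 1 ≤ n →
    ∀ᵐ ω ∂P, IsActive fam pol halt A X I n ω →
      (P⟦U (n + 1) ⁻¹' {true} | infoSigma A X I U n n n n⟧) ω = pol.γ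
  arm : ∀ n, 1 ≤ n → ∀ k : Fin K,
    ∀ᵐ ω ∂P, IsActive fam pol halt A X I n ω →
      (P⟦A (n + 1) ⁻¹' {k} | infoSigma A X I U n n n (n + 1)⟧) ω
        = if U (n + 1) ω = true then
            pol.samplingDist fam (fun t => A t ω) (fun t => X t ω) (I n ω) n k
          else if A n ω = k then 1 else 0

end

/-!
Both claims follow from one fact: almost surely, on the event that the policy never stops, each
`Z_{ij}(n)` with `i` the odd arm grows at least linearly (`IsRun.ae_eventually_mul_le_glr`). For the
non-stopping policy this event is everything. For the policy with a threshold, the leader's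
statistic dominates `Z_i(n) = min_j Z_{ij}(n)`, which would then exceed the threshold, so the event
is null.

The probabilistic input is a Chernoff bound for exponential supermartingales combined with the
Borel–Cantelli lemma (`ae_eventually_sum_le`). It is used three times. Applied to the coins and then
to the arms drawn after successful coins, it shows that every arm is pulled linearly often, since
all sampling distributions are bounded below (`IsRun.ae_eventually_le_pulls`). Applied to the
likelihood ratios of the parameters `η ± δ e_l` and `η` of an arm, it yields the strong law
`Y_k^n = N_k^n ∇A(η) + o(n)` (`IsRun.ae_eventually_norm_armError_le`). The conditional laws of a run
are only prescribed on the event that the policy is active, whose measurability is never needed: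
that event is almost contained in a measurable set on which the relevant conditional probabilities
have the prescribed values.

The rest is deterministic. Relative to the likelihood at the true parameters `(i, η₁, η₂)`, the
log-likelihood of `(j, θ₁, θ₂)` is minus a sum of Bregman divergences of the log partition function
`A`, weighted by numbers of pulls, up to errors `o(n)` times the distances of the parameters
(`ExpFamily.logLik_sub_logLik`). Under `H = j` the odd arm `i` and a third arm, which exists as
`K ≥ 3`, share the parameter `θ₂`, which cannot be close to both `η₁` and `η₂`. Because `A` is
strictly convex by identifiability, the divergences are positive and grow linearly at infinity, and
so dominate the errors uniformly over the possibly unbounded parameter set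
(`ExpFamily.eventually_logLik_le`). Hence the maximum likelihood under `j` is smaller by an
exponential factor, whereas averaging over the prior loses only a subexponential factor
(`ExpFamily.eventually_le_avgLikelihood`).
-/

noncomputable section

/-! ### Exponential supermartingales and conditional probabilities -/

section Probability

variable {Ω : Type*} {m m0 : MeasurableSpace Ω} {P : Measure Ω}

theorem lintegral_mul_indicator_le [IsFiniteMeasure P] (hm : m ≤ m0)
    {D : Set Ω} (hD : MeasurableSet[m] D) {W M : Ω → ℝ≥0∞} (hW : Measurable W)
    (hM : Measurable[m] M)
    (h : ∀ C, MeasurableSet[m] C → C ⊆ D → ∫⁻ ω in C, W ω ∂P ≤ P C) :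
    ∫⁻ ω, M ω * D.indicator W ω ∂P ≤ ∫⁻ ω, M ω ∂P := by
  have hle : (P.withDensity (D.indicator W)).trim hm ≤ P.trim hm := by
    refine Measure.le_iff.2 fun C hC => ?_
    rw [trim_measurableSet_eq hm hC, trim_measurableSet_eq hm hC,
      withDensity_apply _ (hm _ hC), setLIntegral_indicator (hm _ hD)]
    exact (h _ (MeasurableSet.inter hD hC) Set.inter_subset_left).trans
      (measure_mono Set.inter_subset_right)
  calc ∫⁻ ω, M ω * D.indicator W ω ∂P
      = ∫⁻ ω, M ω ∂(P.withDensity (D.indicator W)) := by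
        rw [lintegral_withDensity_eq_lintegral_mul _ (hW.indicator (hm _ hD)) (hM.mono hm le_rfl)]
        simp [mul_comm]
    _ = ∫⁻ ω, M ω ∂((P.withDensity (D.indicator W)).trim hm) := (lintegral_trim hm hM).symm
    _ ≤ ∫⁻ ω, M ω ∂(P.trim hm) := lintegral_mono' hle le_rfl
    _ = ∫⁻ ω, M ω ∂P := lintegral_trim hm hM

/-- Chernoff bound with a Borel–Cantelli argument: if `exp (w n)` has conditional expectation at
most `1` given `F n` on a set `D ∈ F n` which almost contains the event `S n`, then almost surely,
when all `S n` occur, the partial sums of `w` are eventually at most `ε n`. The events `S n`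
themselves need not be measurable. -/
theorem ae_eventually_sum_le [IsProbabilityMeasure P] {F : ℕ → MeasurableSpace Ω}
    (hmono : Monotone F) (hF : ∀ n, F n ≤ m0) {w : ℕ → Ω → ℝ}
    (hw : ∀ n, Measurable[F (n + 1)] (w n)) {S : ℕ → Ω → Prop}
    (hD : ∀ n, ∃ D, MeasurableSet[F n] D ∧ (∀ᵐ ω ∂P, S n ω → ω ∈ D) ∧
      ∀ C, MeasurableSet[F n] C → C ⊆ D →
        ∫⁻ ω in C, ENNReal.ofReal (Real.exp (w n ω)) ∂P ≤ P C)
    {ε : ℝ} (hε : 0 < ε) :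
    ∀ᵐ ω ∂P, (∀ n, S n ω) → ∀ᶠ n : ℕ in atTop, ∑ t ∈ Finset.range n, w t ω ≤ ε * n := by
  choose D hDm hDS hDC using hD
  have hW : ∀ n, Measurable[F (n + 1)] fun ω => ENNReal.ofReal (Real.exp (w n ω)) := fun n =>
    ENNReal.measurable_ofReal.comp (Real.measurable_exp.comp (hw n))
  let M : ℕ → Ω → ℝ≥0∞ := fun n ω => ∏ t ∈ Finset.range n,
    (D t).indicator (fun ω => ENNReal.ofReal (Real.exp (w t ω))) ω
  have hM : ∀ n, Measurable[F n] (M n) := by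
    intro n
    refine Finset.measurable_fun_prod (m := F n) _ fun t ht => ?_
    have htn : t < n := Finset.mem_range.1 ht
    exact Measurable.indicator ((hW t).mono (hmono htn) le_rfl)
      (hmono htn.le _ (hDm t))
  have hint : ∀ n, ∫⁻ ω, M n ω ∂P ≤ 1 := by
    intro n
    induction n with
    | zero => simp [M]
    | succ n ih =>
      refine le_trans ?_ ih
      have := lintegral_mul_indicator_le (P := P) (hF n) (hDm n) ((hW n).mono (hF _) le_rfl)
        (hM n) (hDC n)
      simpa [M, Finset.prod_range_succ] using this
  have htail : ∀ n : ℕ, P {ω | ENNReal.ofReal (Real.exp (ε * n)) ≤ M n ω}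
      ≤ ENNReal.ofReal (Real.exp (-ε)) ^ n := by
    intro n
    have h1 := (mul_meas_ge_le_lintegral₀ (μ := P) ((hM n).mono (hF n) le_rfl).aemeasurable
      (ENNReal.ofReal (Real.exp (ε * n)))).trans (hint n)
    have h2 : ENNReal.ofReal (Real.exp (-ε)) ^ n * ENNReal.ofReal (Real.exp (ε * n)) = 1 := by
      rw [← ENNReal.ofReal_pow (Real.exp_pos _).le, ← ENNReal.ofReal_mul (by positivity),
        ← Real.exp_nat_mul, ← Real.exp_add]
      simp [mul_comm]
    calc _ = ENNReal.ofReal (Real.exp (-ε)) ^ n * (ENNReal.ofReal (Real.exp (ε * n)) *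
            P {ω | ENNReal.ofReal (Real.exp (ε * n)) ≤ M n ω}) := by
          rw [← mul_assoc, h2, one_mul]
      _ ≤ ENNReal.ofReal (Real.exp (-ε)) ^ n * 1 := by gcongr
      _ = _ := mul_one _
  have hsum : ∑' n : ℕ, P {ω | ENNReal.ofReal (Real.exp (ε * n)) ≤ M n ω} ≠ ∞ := by
    refine ne_top_of_le_ne_top ?_ (ENNReal.tsum_le_tsum htail)
    rw [ENNReal.tsum_geometric]
    refine ENNReal.inv_ne_top.2 (tsub_pos_of_lt ?_).ne'
    rw [ENNReal.ofReal_lt_one]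
    simpa using hε
  filter_upwards [ae_eventually_notMem hsum, ae_all_iff.2 hDS] with ω h1 h2 hS
  filter_upwards [h1] with n hn
  have hMn : M n ω = ENNReal.ofReal (Real.exp (∑ t ∈ Finset.range n, w t ω)) := by
    rw [Real.exp_sum, ENNReal.ofReal_prod_of_nonneg fun t _ => (Real.exp_pos _).le]
    exact Finset.prod_congr rfl fun t _ => Set.indicator_of_mem (h2 t (hS t)) _
  simp only [not_le, hMn] at hn
  exact (Real.exp_lt_exp.1 ((ENNReal.ofReal_lt_ofReal_iff (Real.exp_pos _)).1 hn)).le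

theorem setIntegral_condProb [IsFiniteMeasure P] (hm : m ≤ m0)
    {C E : Set Ω} (hC : MeasurableSet[m] C) (hE : MeasurableSet E) :
    ∫ ω in C, (P⟦E | m⟧) ω ∂P = P.real (C ∩ E) := by
  rw [setIntegral_condExp hm ((integrable_const _).indicator hE) hC, setIntegral_indicator hE]
  simp

theorem measureReal_inter_eq_of_condProb [IsFiniteMeasure P] (hm : m ≤ m0)
    {C E : Set Ω} (hC : MeasurableSet[m] C) (hE : MeasurableSet E) {r : ℝ}
    (h : ∀ ω ∈ C, (P⟦E | m⟧) ω = r) : P.real (C ∩ E) = r * P.real C := by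
  rw [← setIntegral_condProb hm hC hE, setIntegral_congr_fun (hm _ hC) h]
  simp [mul_comm]

theorem mul_measureReal_le_of_condProb [IsFiniteMeasure P] (hm : m ≤ m0)
    {C E : Set Ω} (hC : MeasurableSet[m] C) (hE : MeasurableSet E) {r : ℝ}
    (h : ∀ ω ∈ C, r ≤ (P⟦E | m⟧) ω) : r * P.real C ≤ P.real (C ∩ E) := by
  rw [← setIntegral_condProb hm hC hE]
  calc r * P.real C = ∫ _ in C, r ∂P := by simp [mul_comm]
    _ ≤ _ := setIntegral_mono_on (integrable_const _).integrableOn integrable_condExp.integrableOn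
      (hm _ hC) h

/-- An event whose conditional probability vanishes on `S` almost surely does not occur on `S`,
even when `S` is not measurable. -/
theorem ae_notMem_of_condProb_eq_zero [IsFiniteMeasure P] (hm : m ≤ m0)
    {E : Set Ω} (hE : MeasurableSet E) {S : Ω → Prop}
    (h : ∀ᵐ ω ∂P, S ω → (P⟦E | m⟧) ω = 0) : ∀ᵐ ω ∂P, S ω → ω ∉ E := by
  have hC : MeasurableSet[m] {ω | (P⟦E | m⟧) ω = 0} :=
    stronglyMeasurable_condExp.measurable (measurableSet_singleton 0)
  have h0 := measureReal_inter_eq_of_condProb hm hC hE (r := 0) fun ω hω => hω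
  rw [zero_mul, measureReal_eq_zero_iff] at h0
  filter_upwards [h, measure_eq_zero_iff_ae_notMem.1 h0] with ω h1 h2 hS hE
  exact h2 ⟨h1 hS, hE⟩

/-- The exponential rate at which a Bernoulli(`c`) frequency is kept away from zero: minus the
logarithm of the expectation of `exp (-B)` for `B` Bernoulli(`c`). -/
def bernoulliRate (c : ℝ) : ℝ := -Real.log (1 - c * (1 - Real.exp (-1)))

theorem exp_bernoulliRate_mul {c : ℝ} (hc1 : c ≤ 1) :
    Real.exp (bernoulliRate c) * (1 - c * (1 - Real.exp (-1))) = 1 := by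
  have h0 := Real.exp_pos (-1)
  have h1 : Real.exp (-1) < 1 := by simp
  have hpos : 0 < 1 - c * (1 - Real.exp (-1)) := by nlinarith
  rw [bernoulliRate, Real.exp_neg, Real.exp_log hpos, inv_mul_cancel₀ hpos.ne']

theorem bernoulliRate_pos {c : ℝ} (hc : 0 < c) (hc1 : c ≤ 1) : 0 < bernoulliRate c := by
  have h0 := Real.exp_pos (-1)
  have h1 : Real.exp (-1) < 1 := by simp
  exact neg_pos.2 (Real.log_neg (by nlinarith) (by nlinarith))

open Classical in
/-- If `E n` has conditional probability at least `c` given `F n` on `V n`, then the number of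
occurrences of `V t ∩ E t` is at least a positive multiple of the number of occurrences of `V t`,
up to a sublinear error. -/
theorem ae_eventually_count_ge [IsProbabilityMeasure P] {F : ℕ → MeasurableSpace Ω}
    (hmono : Monotone F) (hF : ∀ n, F n ≤ m0) {E V : ℕ → Set Ω}
    (hE : ∀ n, MeasurableSet[F (n + 1)] (E n)) (hV : ∀ n, MeasurableSet[F n] (V n))
    {S : ℕ → Ω → Prop} {c : ℝ} (hc1 : c ≤ 1)
    (h : ∀ n, ∀ᵐ ω ∂P, S n ω → ω ∈ V n → c ≤ (P⟦E n | F n⟧) ω) {ε : ℝ} (hε : 0 < ε) :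
    ∀ᵐ ω ∂P, (∀ n, S n ω) → ∀ᶠ n : ℕ in atTop,
      bernoulliRate c * (∑ t ∈ Finset.range n, if ω ∈ V t then (1 : ℝ) else 0)
        - (∑ t ∈ Finset.range n, if ω ∈ V t ∩ E t then (1 : ℝ) else 0) ≤ ε * n := by
  set b := bernoulliRate c with hb
  let w : ℕ → Ω → ℝ := fun t ω =>
    b * (if ω ∈ V t then (1 : ℝ) else 0) - (if ω ∈ V t ∩ E t then (1 : ℝ) else 0)
  have hVs : ∀ n, MeasurableSet[F (n + 1)] (V n) := fun n => hmono n.le_succ _ (hV n)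
  have key := ae_eventually_sum_le (P := P) hmono hF (w := w) (S := S) (ε := ε) ?_ ?_ hε
  · filter_upwards [key] with ω h1 hS
    filter_upwards [h1 hS] with n hn
    rwa [Finset.mul_sum, ← Finset.sum_sub_distrib]
  · intro n
    refine Measurable.sub (Measurable.const_mul (Measurable.ite (hVs n) ?_ ?_) _)
      (Measurable.ite (MeasurableSet.inter (hVs n) (hE n)) ?_ ?_) <;> exact measurable_const
  · intro n
    have hg : MeasurableSet[F n] {ω | c ≤ (P⟦E n | F n⟧) ω} :=
      stronglyMeasurable_condExp.measurable measurableSet_Ici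
    refine ⟨(V n)ᶜ ∪ {ω | c ≤ (P⟦E n | F n⟧) ω}, (hV n).compl.union hg, ?_, ?_⟩
    · filter_upwards [h n] with ω h1 hS
      by_cases hω : ω ∈ V n
      · exact Or.inr (h1 hS hω)
      · exact Or.inl hω
    intro C hC hCD
    have hEm := hF _ _ (hE n)
    have hCV : MeasurableSet[F n] (C ∩ V n) := hC.inter (hV n)
    have hprob : c * P.real (C ∩ V n) ≤ P.real (C ∩ V n ∩ E n) :=
      mul_measureReal_le_of_condProb (hF n) hCV hEm fun ω hω =>
        (hCD hω.1).resolve_left fun h => h hω.2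
    have hdiff : P.real ((C ∩ V n) \ E n) = P.real (C ∩ V n) - P.real (C ∩ V n ∩ E n) := by
      rw [← measureReal_inter_add_sdiff (s := C ∩ V n) hEm]; ring
    rw [← lintegral_inter_add_sdiff _ C (hF n _ (hV n)),
      ← measure_inter_add_sdiff C (hF n _ (hV n)), ← lintegral_inter_add_sdiff _ (C ∩ V n) hEm]
    have e1 : ∫⁻ ω in C ∩ V n ∩ E n, ENNReal.ofReal (Real.exp (w n ω)) ∂P
        = ENNReal.ofReal (Real.exp (b - 1) * P.real (C ∩ V n ∩ E n)) := by
      rw [setLIntegral_congr_fun (g := fun _ => ENNReal.ofReal (Real.exp (b - 1)))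
        ((hF n _ hCV).inter hEm), setLIntegral_const, ENNReal.ofReal_mul (Real.exp_pos _).le,
        ofReal_measureReal]
      intro ω hω
      simp [w, hω.1.2, hω.2]
    have e2 : ∫⁻ ω in (C ∩ V n) \ E n, ENNReal.ofReal (Real.exp (w n ω)) ∂P
        = ENNReal.ofReal (Real.exp b * P.real ((C ∩ V n) \ E n)) := by
      rw [setLIntegral_congr_fun (g := fun _ => ENNReal.ofReal (Real.exp b))
        ((hF n _ hCV).diff hEm), setLIntegral_const, ENNReal.ofReal_mul (Real.exp_pos _).le,
        ofReal_measureReal]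
      intro ω hω
      simp [w, hω.1.2, hω.2]
    have e3 : ∫⁻ ω in C \ V n, ENNReal.ofReal (Real.exp (w n ω)) ∂P = P (C \ V n) := by
      rw [setLIntegral_congr_fun (g := fun _ => 1)
        ((hF n _ hC).diff (hF n _ (hV n))), setLIntegral_const, one_mul]
      intro ω hω
      simp [w, hω.2]
    rw [e1, e2, e3, ← ENNReal.ofReal_add (by positivity) (by positivity)]
    gcongr
    rw [← ofReal_measureReal (μ := P) (s := C ∩ V n)]
    refine ENNReal.ofReal_le_ofReal ?_
    have hexp := exp_bernoulliRate_mul hc1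
    rw [← hb] at hexp
    have h1 : Real.exp (-1) < 1 := by simp
    calc Real.exp (b - 1) * P.real (C ∩ V n ∩ E n) + Real.exp b * P.real ((C ∩ V n) \ E n)
        = Real.exp b * (P.real (C ∩ V n) - (1 - Real.exp (-1)) * P.real (C ∩ V n ∩ E n)) := by
          rw [hdiff, sub_eq_add_neg b, Real.exp_add]; ring
      _ ≤ Real.exp b * (P.real (C ∩ V n) - (1 - Real.exp (-1)) * (c * P.real (C ∩ V n))) := by
          gcongr
      _ = Real.exp b * (1 - c * (1 - Real.exp (-1))) * P.real (C ∩ V n) := by ring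
      _ = P.real (C ∩ V n) := by rw [hexp, one_mul]

/-- Conditional probabilities of events `X ∈ B` determine conditional expectations of nonnegative
functions of `X`. The set `D` absorbs the exceptional null sets of the countably many events that
approximate `φ`, so that the event `S` need not be measurable. -/
theorem exists_setLIntegral_comp_eq_of_condProb [IsFiniteMeasure P] (hm : m ≤ m0) {𝒳 ι : Type*}
    [MeasurableSpace 𝒳] [MeasurableSpace ι] [DiscreteMeasurableSpace ι] {X : Ω → 𝒳}
    (hX : Measurable X) {a : Ω → ι} (ha : Measurable[m] a) {Q : ι → Measure 𝒳}
    [∀ k, IsFiniteMeasure (Q k)] {S : Ω → Prop}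
    (h : ∀ B, MeasurableSet B → ∀ᵐ ω ∂P, S ω → (P⟦X ⁻¹' B | m⟧) ω = (Q (a ω)).real B)
    {φ : 𝒳 → ℝ≥0∞} (hφ : Measurable φ) :
    ∃ D, MeasurableSet[m] D ∧ (∀ᵐ ω ∂P, S ω → ω ∈ D) ∧
      ∀ k C, MeasurableSet[m] C → C ⊆ D → (∀ ω ∈ C, a ω = k) →
        ∫⁻ ω in C, φ (X ω) ∂P = (∫⁻ x, φ x ∂(Q k)) * P C := by
  let B : ℕ → ℝ≥0∞ → Set 𝒳 := fun n y => SimpleFunc.eapprox φ n ⁻¹' {y}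
  have hB : ∀ n y, MeasurableSet (B n y) := fun n y => SimpleFunc.measurableSet_fiber _ _
  let D : Set Ω := ⋂ n, ⋂ y ∈ (SimpleFunc.eapprox φ n).range,
    {ω | (P⟦X ⁻¹' (B n y) | m⟧) ω = (Q (a ω)).real (B n y)}
  refine ⟨D, ?_, ?_, ?_⟩
  · refine MeasurableSet.iInter fun n => Finset.measurableSet_biInter _ fun y _ => ?_
    refine measurableSet_eq_fun stronglyMeasurable_condExp.measurable ?_
    exact (Measurable.of_discrete (f := fun k => (Q k).real (B n y))).comp ha
  · have : ∀ᵐ ω ∂P, ∀ n, ∀ y ∈ (SimpleFunc.eapprox φ n).range,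
        S ω → (P⟦X ⁻¹' (B n y) | m⟧) ω = (Q (a ω)).real (B n y) :=
      ae_all_iff.2 fun n => (Finset.eventually_all _).2 fun y _ => h _ (hB n y)
    filter_upwards [this] with ω hω hS
    exact Set.mem_iInter.2 fun n => Set.mem_iInter₂.2 fun y hy => hω n y hy hS
  · intro k C hC hCD hk
    have hCB : ∀ n, ∀ y ∈ (SimpleFunc.eapprox φ n).range,
        (P.restrict C).map X (B n y) = Q k (B n y) * P C := by
      intro n y hy
      rw [Measure.map_apply hX (hB n y), Measure.restrict_apply (hX (hB n y)), Set.inter_comm]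
      have := measureReal_inter_eq_of_condProb (P := P) hm hC (hX (hB n y))
        (r := (Q k).real (B n y)) fun ω hω => by
          rw [← hk ω hω]
          exact Set.mem_iInter₂.1 (Set.mem_iInter.1 (hCD hω) n) y hy
      rw [← ofReal_measureReal, this, ENNReal.ofReal_mul (by positivity), ofReal_measureReal,
        ofReal_measureReal]
    rw [← lintegral_map (μ := P.restrict C) hφ hX, lintegral_eq_iSup_eapprox_lintegral hφ,
      lintegral_eq_iSup_eapprox_lintegral hφ, ENNReal.iSup_mul]
    refine iSup_congr fun n => ?_
    rw [SimpleFunc.lintegral, SimpleFunc.lintegral, Finset.sum_mul]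
    exact Finset.sum_congr rfl fun y hy => by rw [hCB n y hy, mul_assoc]

end Probability

/-! ### The log partition function and its Bregman divergence -/

namespace ExpFamily

variable {𝒳 : Type*} [MeasurableSpace 𝒳] {d : ℕ} (fam : ExpFamily 𝒳 d)

local notation "V" => EuclideanSpace ℝ (Fin d)

theorem measurable_inner_T (η : V) : Measurable fun x => ⟪η, fam.T x⟫ :=
  Measurable.inner measurable_const fam.measurable_T

theorem measurable_density (η : V) : Measurable (fam.density η) :=
  fam.measurable_h.mul (Real.measurable_exp.comp ((fam.measurable_inner_T η).sub_const _))

theorem density_nonneg (η : V) (x : 𝒳) : 0 ≤ fam.density η x :=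
  mul_nonneg (fam.h_nonneg x) (Real.exp_pos _).le

theorem density_eq (η : V) (x : 𝒳) : fam.density η x
    = Real.exp (-fam.logPartition η) * (fam.h x * Real.exp ⟪η, fam.T x⟫) := by
  rw [density, sub_eq_add_neg, Real.exp_add]; ring

theorem integrable_density {η : V} (hη : η ∈ fam.Θ) : Integrable (fam.density η) fam.ν := by
  simp_rw [funext (fam.density_eq η)]
  exact (fam.integrable_weight η hη).const_mul _

theorem integral_density {η : V} (hη : η ∈ fam.Θ) : ∫ x, fam.density η x ∂fam.ν = 1 := by
  simp_rw [density_eq]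
  rw [integral_const_mul, logPartition, Real.exp_neg, Real.exp_log (fam.integral_weight_pos η hη),
    inv_mul_cancel₀ (fam.integral_weight_pos η hη).ne']

theorem lintegral_density {η : V} (hη : η ∈ fam.Θ) :
    ∫⁻ x, ENNReal.ofReal (fam.density η x) ∂fam.ν = 1 := by
  rw [← ofReal_integral_eq_lintegral_ofReal (fam.integrable_density hη)
    (Eventually.of_forall (fam.density_nonneg η)), fam.integral_density hη, ENNReal.ofReal_one]

theorem isProbabilityMeasure_law {η : V} (hη : η ∈ fam.Θ) : IsProbabilityMeasure (fam.law η) :=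
  ⟨by rw [law, withDensity_apply _ MeasurableSet.univ, setLIntegral_univ,
    fam.lintegral_density hη]⟩

theorem law_setOf_h_eq_zero (η : V) : fam.law η {x | fam.h x = 0} = 0 := by
  have hm : MeasurableSet {x | fam.h x = 0} := fam.measurable_h (measurableSet_singleton 0)
  rw [law, withDensity_apply _ hm, setLIntegral_congr_fun (g := fun _ => 0) hm]
  · simp
  · intro x hx
    have hx : fam.h x = 0 := hx
    simp [density, hx]

/-- The moment generating function of the sufficient statistic, or the total mass of a likelihood
ratio. -/
theorem lintegral_exp_inner_law {η s : V} (hs : η + s ∈ fam.Θ) :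
    ∫⁻ x, ENNReal.ofReal (Real.exp
      (⟪s, fam.T x⟫ - (fam.logPartition (η + s) - fam.logPartition η))) ∂(fam.law η) = 1 := by
  have hm : Measurable fun x => ENNReal.ofReal (Real.exp
      (⟪s, fam.T x⟫ - (fam.logPartition (η + s) - fam.logPartition η))) :=
    (Real.measurable_exp.comp ((fam.measurable_inner_T s).sub_const _)).ennreal_ofReal
  rw [law, lintegral_withDensity_eq_lintegral_mul _ (fam.measurable_density η).ennreal_ofReal hm,
    ← fam.lintegral_density hs]
  refine lintegral_congr fun x => ?_
  rw [Pi.mul_apply, ← ENNReal.ofReal_mul (fam.density_nonneg η x), density, density, mul_assoc,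
    ← Real.exp_add, inner_add_left]
  ring_nf

/-- Strict convexity is strict convexity of `exp` integrated against `h dν`: equality would make
the densities of two distinct members agree almost everywhere. -/
theorem strictConvexOn_logPartition (hfam : fam.IsRegular) :
    StrictConvexOn ℝ fam.Θ fam.logPartition := by
  refine ⟨fam.convex_Θ, fun η hη θ hθ hne a b ha hb hab => ?_⟩
  have hmid : a • η + b • θ ∈ fam.Θ := fam.convex_Θ hη hθ ha.le hb.le hab
  simp only [smul_eq_mul]
  set Δ := fam.logPartition (a • η + b • θ)
    - (a * fam.logPartition η + b * fam.logPartition θ) with hΔ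
  suffices Real.exp Δ < 1 by
    have := Real.exp_lt_one_iff.1 this
    linarith
  let g : 𝒳 → ℝ := fun x => a * fam.density η x + b * fam.density θ x
    - Real.exp Δ * fam.density (a • η + b • θ) x
  have hg : ∀ x, g x = fam.h x * (a * Real.exp (⟪η, fam.T x⟫ - fam.logPartition η)
      + b * Real.exp (⟪θ, fam.T x⟫ - fam.logPartition θ)
      - Real.exp (a * (⟪η, fam.T x⟫ - fam.logPartition η)
        + b * (⟪θ, fam.T x⟫ - fam.logPartition θ))) := by
    intro x
    have : a * (⟪η, fam.T x⟫ - fam.logPartition η) + b * (⟪θ, fam.T x⟫ - fam.logPartition θ)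
        = Δ + (⟪a • η + b • θ, fam.T x⟫ - fam.logPartition (a • η + b • θ)) := by
      rw [hΔ, inner_add_left, real_inner_smul_left, real_inner_smul_left]; ring
    rw [this, Real.exp_add]
    simp only [g, density]
    ring
  have hconv := strictConvexOn_exp
  have hg0 : 0 ≤ g := fun x => by
    rw [Pi.zero_apply, hg]
    refine mul_nonneg (fam.h_nonneg x) (sub_nonneg.2 ?_)
    exact hconv.convexOn.2 (Set.mem_univ _) (Set.mem_univ _) ha.le hb.le hab
  have hi1 := (fam.integrable_density hη).const_mul a
  have hi2 := (fam.integrable_density hθ).const_mul b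
  have hi3 := (fam.integrable_density hmid).const_mul (Real.exp Δ)
  have hi12 : Integrable (fun x => a * fam.density η x + b * fam.density θ x) fam.ν := hi1.add hi2
  have hgi : Integrable g fam.ν := hi12.sub hi3
  have hint : ∫ x, g x ∂fam.ν = 1 - Real.exp Δ := by
    simp only [g]
    rw [integral_sub hi12 hi3, integral_add hi1 hi2, integral_const_mul, integral_const_mul,
      integral_const_mul, fam.integral_density hη, fam.integral_density hθ,
      fam.integral_density hmid]
    linarith
  have hpos : 0 < ∫ x, g x ∂fam.ν := by
    refine (integral_nonneg hg0).lt_of_ne' fun h0 => hne (hfam.identifiable hη hθ ?_)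
    refine withDensity_congr_ae ?_
    filter_upwards [(integral_eq_zero_iff_of_nonneg hg0 hgi).1 h0] with x hx
    rw [Pi.zero_apply, hg, mul_eq_zero] at hx
    rcases hx with hx | hx
    · simp [density, hx]
    · have : ⟪η, fam.T x⟫ - fam.logPartition η = ⟪θ, fam.T x⟫ - fam.logPartition θ := by
        by_contra hxy
        have := hconv.2 (Set.mem_univ _) (Set.mem_univ _) hxy ha hb hab
        simp only [smul_eq_mul] at this
        linarith
      simp [density, this]
  linarith

theorem differentiableAt_logPartition (hfam : fam.IsRegular) {η : V} (hη : η ∈ fam.Θ) :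
    DifferentiableAt ℝ fam.logPartition η :=
  ((hfam.contDiffOn_logPartition.differentiableOn (by norm_num)) η hη).differentiableAt
    (fam.isOpen_Θ.mem_nhds hη)

theorem continuousOn_logPartition (hfam : fam.IsRegular) : ContinuousOn fam.logPartition fam.Θ :=
  hfam.contDiffOn_logPartition.continuousOn

/-- The Bregman divergence `A(θ) - A(η) - ⟨∇A(η), θ - η⟩` of the log partition function, which is
the relative entropy of the member `η` with respect to the member `θ`. -/
def bregman (η θ : V) : ℝ :=
  fam.logPartition θ - fam.logPartition η - ⟪gradient fam.logPartition η, θ - η⟫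

theorem bregman_pos (hfam : fam.IsRegular) {η θ : V} (hη : η ∈ fam.Θ) (hθ : θ ∈ fam.Θ)
    (hne : θ ≠ η) : 0 < fam.bregman η θ := by
  have hconv := fam.strictConvexOn_logPartition hfam
  let ℓ : ℝ → V := fun t => η + t • (θ - η)
  have hℓmem : ∀ t ∈ Set.Icc (0 : ℝ) 1, ℓ t ∈ fam.Θ := fun t ht =>
    fam.convex_Θ.add_smul_sub_mem hη hθ ht
  have hℓ : StrictConvexOn ℝ (Set.Icc (0 : ℝ) 1) (fam.logPartition ∘ ℓ) := by
    refine ⟨convex_Icc 0 1, fun s hs t ht hst a b ha hb hab => ?_⟩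
    have hst' : ℓ s ≠ ℓ t := fun h => hst
      (smul_left_injective ℝ (sub_ne_zero.2 hne) (add_left_cancel h))
    have := hconv.2 (hℓmem s hs) (hℓmem t ht) hst' ha hb hab
    have e : ℓ (a • s + b • t) = a • ℓ s + b • ℓ t := by
      have hb' : b = 1 - a := by linarith
      subst hb'
      simp only [ℓ, smul_eq_mul]
      module
    simpa only [Function.comp_apply, e] using this
  have hd : HasDerivAt (fam.logPartition ∘ ℓ) ⟪gradient fam.logPartition η, θ - η⟫ 0 := by
    have h1 : HasDerivAt ℓ (θ - η) 0 := by
      simpa [ℓ] using ((hasDerivAt_id (0 : ℝ)).smul_const (θ - η)).const_add η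
    have h2 : HasFDerivAt fam.logPartition (fderiv ℝ fam.logPartition η) (ℓ 0) := by
      simpa [ℓ] using (fam.differentiableAt_logPartition hfam hη).hasFDerivAt
    have := h2.comp_hasDerivAt 0 h1
    rwa [← inner_gradient_left] at this
  have := hℓ.lt_slope_of_hasDerivAt (by simp) (by simp) zero_lt_one hd
  simp only [slope_def_field, Function.comp_apply, ℓ, one_smul, zero_smul, add_zero,
    add_sub_cancel, sub_zero, div_one] at this
  rw [bregman]
  linarith

theorem bregman_nonneg (hfam : fam.IsRegular) {η θ : V} (hη : η ∈ fam.Θ) (hθ : θ ∈ fam.Θ) :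
    0 ≤ fam.bregman η θ := by
  rcases eq_or_ne θ η with rfl | hne
  · simp [bregman]
  · exact (fam.bregman_pos hfam hη hθ hne).le

/-- The Bregman divergence grows at least linearly: it is bounded below on a small sphere around `η`
by compactness, and convex along rays from `η`. -/
theorem exists_mul_norm_sub_le_bregman (hfam : fam.IsRegular) {η : V} (hη : η ∈ fam.Θ) {r₀ : ℝ}
    (hr₀ : 0 < r₀) : ∃ μ, 0 < μ ∧ ∀ θ ∈ fam.Θ, μ * (‖θ - η‖ - r₀) ≤ fam.bregman η θ := by
  obtain ⟨r₁, hr₁, hball⟩ := Metric.nhds_basis_closedBall.mem_iff.1 (fam.isOpen_Θ.mem_nhds hη)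
  set r := min r₀ r₁ with hr
  have hrpos : 0 < r := lt_min hr₀ hr₁
  have hsub : Metric.sphere η r ⊆ fam.Θ := fun θ hθ => hball
    (Metric.closedBall_subset_closedBall (min_le_right _ _) (Metric.sphere_subset_closedBall hθ))
  have hcont : ContinuousOn (fam.bregman η) fam.Θ := by
    unfold bregman
    exact ((fam.continuousOn_logPartition hfam).sub continuousOn_const).sub
      (by fun_prop)
  obtain ⟨μ, hμ, hle⟩ : ∃ μ, 0 < μ ∧ ∀ θ ∈ Metric.sphere η r, μ ≤ fam.bregman η θ := by
    rcases (Metric.sphere η r).eq_empty_or_nonempty with he | hne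
    · exact ⟨1, one_pos, by simp [he]⟩
    · obtain ⟨θ₀, hθ₀, hmin⟩ := (isCompact_sphere η r).exists_isMinOn hne (hcont.mono hsub)
      refine ⟨_, fam.bregman_pos hfam hη (hsub hθ₀) ?_, fun θ hθ => hmin hθ⟩
      rintro rfl
      simp at hθ₀
      linarith
  refine ⟨μ / r, by positivity, fun θ hθ => ?_⟩
  have hrr₀ : r ≤ r₀ := min_le_left _ _
  rcases lt_or_ge ‖θ - η‖ r with hθr | hθr
  · exact (mul_nonpos_of_nonneg_of_nonpos (by positivity) (by linarith)).trans
      (fam.bregman_nonneg hfam hη hθ)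
  refine le_trans (mul_le_mul_of_nonneg_left (sub_le_self _ hr₀.le) (by positivity)) ?_
  have hn : 0 < ‖θ - η‖ := hrpos.trans_le hθr
  set t := r / ‖θ - η‖ with ht
  have ht0 : 0 < t := by positivity
  have ht1 : t ≤ 1 := (div_le_one hn).2 hθr
  have hsphere : η + t • (θ - η) ∈ Metric.sphere η r := by
    simp [ht, norm_smul, abs_of_pos hrpos, hn.ne']
  have h1 := hle _ hsphere
  have h2 := (fam.strictConvexOn_logPartition hfam).convexOn.2 hη hθ (sub_nonneg.2 ht1) ht0.le
    (by ring)
  have e : η + t • (θ - η) = (1 - t) • η + t • θ := by module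
  have h3 : fam.bregman η (η + t • (θ - η)) ≤ t * fam.bregman η θ := by
    simp only [smul_eq_mul] at h2
    rw [bregman, bregman, add_sub_cancel_left, inner_smul_right, e]
    linarith
  have h4 : μ ≤ r / ‖θ - η‖ * fam.bregman η θ := h1.trans h3
  rw [div_mul_eq_mul_div, div_le_iff₀ hrpos]
  rw [div_mul_eq_mul_div, le_div_iff₀ hn] at h4
  linarith

/-! ### Growth of the modified likelihood ratio along a fixed sequence -/

variable {K : ℕ}

theorem sum_pulls (a : ℕ → Fin K) (n : ℕ) : ∑ k, pulls a k n = n := by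
  simp only [pulls]
  rw [← Finset.card_eq_sum_card_fiberwise (fun _ _ => Finset.mem_coe.2 (Finset.mem_univ _))]
  simp

theorem pulls_le (a : ℕ → Fin K) (k : Fin K) (n : ℕ) : pulls a k n ≤ n := by
  conv_rhs => rw [← sum_pulls a n]
  exact Finset.single_le_sum (f := fun k => pulls a k n) (fun _ _ => Nat.zero_le _)
    (Finset.mem_univ k)

/-- The deviation of the sufficient statistic of an arm from its conditional expectation, when the
arm has canonical parameter `η`; the expectation parameter is encoded as the gradient of `A`. -/
def armError (a : ℕ → Fin K) (x : ℕ → 𝒳) (η : V) (k : Fin K) (n : ℕ) : V :=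
  fam.armSum a x k n - (pulls a k n : ℝ) • gradient fam.logPartition η

/-- The logarithm of the likelihood without the carrier factor `∏ h(X_t)`. -/
def logLik (a : ℕ → Fin K) (x : ℕ → 𝒳) (n : ℕ) (j : Fin K) (θ₁ θ₂ : V) : ℝ :=
  ⟪θ₁, fam.armSum a x j n⟫ - (pulls a j n : ℝ) * fam.logPartition θ₁
    + (⟪θ₂, fam.totalSum a x n - fam.armSum a x j n⟫
        - ((n : ℝ) - (pulls a j n : ℝ)) * fam.logPartition θ₂)

theorem likelihood_eq (a : ℕ → Fin K) (x : ℕ → 𝒳) (n : ℕ) (j : Fin K) (θ₁ θ₂ : V) :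
    fam.likelihood a x n j θ₁ θ₂ = ENNReal.ofReal
      ((∏ t ∈ Finset.Icc 1 n, fam.h (x t)) * Real.exp (fam.logLik a x n j θ₁ θ₂)) := by
  rw [likelihood, logLik, Real.exp_add, mul_assoc]

theorem sum_eq_add_add_sum_erase {M : Type*} [AddCommMonoid M] {i j : Fin K} (hij : j ≠ i)
    (f : Fin K → M) :
    ∑ k, f k = f i + f j + ∑ k ∈ (Finset.univ.erase i).erase j, f k := by
  rw [add_assoc, Finset.add_sum_erase _ _ (by simp [hij]), Finset.add_sum_erase _ _ (by simp)]

/-- The log-likelihood of an alternative `(j, θ₁, θ₂)` relative to the configuration `(i, η₁, η₂)`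
splits into Bregman divergences weighted by the numbers of pulls, and error terms. -/
theorem logLik_sub_logLik (a : ℕ → Fin K) (x : ℕ → 𝒳) (n : ℕ) {i j : Fin K} (hij : j ≠ i)
    (η₁ η₂ θ₁ θ₂ : V) :
    fam.logLik a x n j θ₁ θ₂ - fam.logLik a x n i η₁ η₂
      = (⟪θ₁ - η₂, fam.armError a x η₂ j n⟫ - pulls a j n * fam.bregman η₂ θ₁)
        + (⟪θ₂ - η₁, fam.armError a x η₁ i n⟫ - pulls a i n * fam.bregman η₁ θ₂)
        + (⟪θ₂ - η₂, ∑ k ∈ (Finset.univ.erase i).erase j, fam.armError a x η₂ k n⟫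
          - (∑ k ∈ (Finset.univ.erase i).erase j, (pulls a k n : ℝ)) * fam.bregman η₂ θ₂) := by
  have hY : fam.totalSum a x n = fam.armSum a x i n + fam.armSum a x j n
      + ∑ k ∈ (Finset.univ.erase i).erase j, fam.armSum a x k n := sum_eq_add_add_sum_erase hij _
  have hN : (n : ℝ) = pulls a i n + pulls a j n
      + ∑ k ∈ (Finset.univ.erase i).erase j, (pulls a k n : ℝ) := by
    conv_lhs => rw [← sum_pulls a n, Nat.cast_sum]
    exact sum_eq_add_add_sum_erase hij _
  have hE : ∑ k ∈ (Finset.univ.erase i).erase j, fam.armError a x η₂ k n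
      = ∑ k ∈ (Finset.univ.erase i).erase j, fam.armSum a x k n
        - (∑ k ∈ (Finset.univ.erase i).erase j, (pulls a k n : ℝ))
          • gradient fam.logPartition η₂ := by
    rw [Finset.sum_smul, ← Finset.sum_sub_distrib]
    rfl
  rw [hE, logLik, logLik, hY, hN]
  generalize ∑ k ∈ (Finset.univ.erase i).erase j, fam.armSum a x k n = Yr
  generalize ∑ k ∈ (Finset.univ.erase i).erase j, (pulls a k n : ℝ) = Nr
  simp only [bregman, armError, inner_sub_left, inner_sub_right, inner_add_right,
    inner_smul_right, real_inner_comm (gradient fam.logPartition _)]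
  ring

/-- The maximum likelihood of a wrong hypothesis is exponentially small relative to the likelihood
of the true configuration: a common parameter for the odd arm `i` and a third arm is far from one
of `η₁` and `η₂`, and both arms are sampled linearly often. -/
theorem eventually_logLik_le (hK : 3 ≤ K) (hfam : fam.IsRegular) {a : ℕ → Fin K} {x : ℕ → 𝒳}
    {i j : Fin K} (hij : j ≠ i) {η₁ η₂ : V} (hη₁ : η₁ ∈ fam.Θ) (hη₂ : η₂ ∈ fam.Θ) (hη : η₁ ≠ η₂)
    {c : ℝ} (hc : 0 < c) (hN : ∀ k, ∀ᶠ n : ℕ in atTop, c * n ≤ pulls a k n)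
    (hY : ∀ k, ∀ ε : ℝ, 0 < ε → ∀ᶠ n : ℕ in atTop,
      ‖fam.armError a x (armParam i η₁ η₂ k) k n‖ ≤ ε * n) :
    ∃ δ, 0 < δ ∧ ∀ᶠ n : ℕ in atTop, ∀ θ₁ ∈ fam.Θ, ∀ θ₂ ∈ fam.Θ,
      fam.logLik a x n j θ₁ θ₂ ≤ fam.logLik a x n i η₁ η₂ - δ * n := by
  set ρ := ‖η₁ - η₂‖ with hρdef
  have hρ : 0 < ρ := norm_pos_iff.2 (sub_ne_zero.2 hη)
  obtain ⟨μ₁, hμ₁, hB₁⟩ := fam.exists_mul_norm_sub_le_bregman hfam hη₁ (r₀ := ρ / 8) (by positivity)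
  obtain ⟨μ₂, hμ₂, hB₂⟩ := fam.exists_mul_norm_sub_le_bregman hfam hη₂ (r₀ := ρ / 8) (by positivity)
  set μ := min μ₁ μ₂ with hμdef
  have hμ : 0 < μ := lt_min hμ₁ hμ₂
  -- the bounds survive a smaller factor even where they are negative, as divergences are not
  have shrink : ∀ {ν B u : ℝ}, μ ≤ ν → 0 ≤ B → ν * u ≤ B → μ * u ≤ B := by
    intro ν B u hν hB h
    rcases le_total 0 u with hu | hu
    · exact (mul_le_mul_of_nonneg_right hν hu).trans h
    · exact (mul_nonpos_of_nonneg_of_nonpos hμ.le hu).trans hB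
  have hB₁' : ∀ θ ∈ fam.Θ, μ * (‖θ - η₁‖ - ρ / 8) ≤ fam.bregman η₁ θ := fun θ hθ =>
    shrink (min_le_left _ _) (fam.bregman_nonneg hfam hη₁ hθ) (hB₁ θ hθ)
  have hB₂' : ∀ θ ∈ fam.Θ, μ * (‖θ - η₂‖ - ρ / 8) ≤ fam.bregman η₂ θ := fun θ hθ =>
    shrink (min_le_right _ _) (fam.bregman_nonneg hfam hη₂ hθ) (hB₂ θ hθ)
  -- the sum of at most `K` errors of size `ε n` is at most a quarter of the linear gain `c μ n`
  set ε := c * μ / (4 * K) with hεdef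
  have hK0 : (0 : ℝ) < K := by exact_mod_cast (by omega : 0 < K)
  have hε : 0 < ε := by positivity
  have hεK : ε * K = c * μ / 4 := by rw [hεdef]; field_simp
  have hεle : ε ≤ c * μ / 4 := by
    rw [← hεK]
    exact le_mul_of_one_le_right hε.le (by exact_mod_cast (by omega : 1 ≤ K))
  -- a third arm, whose pulls penalise every `θ₂` away from `η₂`
  obtain ⟨k₀, hk₀⟩ : ((Finset.univ.erase i).erase j : Finset (Fin K)).Nonempty := by
    rw [← Finset.card_pos, Finset.card_erase_of_mem (by simp [hij]),
      Finset.card_erase_of_mem (by simp), Finset.card_univ, Fintype.card_fin]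
    omega
  refine ⟨c * μ * ρ / 4, by positivity, ?_⟩
  filter_upwards [(eventually_all (ι := Fin K)).2 hN,
    (eventually_all (ι := Fin K)).2 fun k => hY k ε hε] with n hNn hYn θ₁ hθ₁ θ₂ hθ₂
  have hn : (0 : ℝ) ≤ n := Nat.cast_nonneg n
  have ei : ‖fam.armError a x η₁ i n‖ ≤ c * μ / 4 * n := by
    have := hYn i
    simp only [armParam, if_true] at this
    exact this.trans (by gcongr)
  have ek : ∀ k, k ≠ i → ‖fam.armError a x η₂ k n‖ ≤ ε * n := by
    intro k hk
    have := hYn k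
    rwa [armParam, if_neg hk] at this
  have ej : ‖fam.armError a x η₂ j n‖ ≤ c * μ / 4 * n := (ek j hij).trans (by gcongr)
  have er : ‖∑ k ∈ (Finset.univ.erase i).erase j, fam.armError a x η₂ k n‖ ≤ c * μ / 4 * n := by
    refine (norm_sum_le_of_le _ fun k hk => ek k ?_).trans ?_
    · exact (Finset.mem_erase.1 (Finset.mem_of_mem_erase hk)).1
    · rw [Finset.sum_const, nsmul_eq_mul, ← hεK]
      have : (((Finset.univ.erase i).erase j : Finset (Fin K)).card : ℝ) ≤ K := by
        exact_mod_cast (Finset.card_le_univ _).trans_eq (Fintype.card_fin K)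
      calc _ ≤ (K : ℝ) * (ε * n) := by gcongr
        _ = ε * K * n := by ring
  have hr : c * n ≤ ∑ k ∈ (Finset.univ.erase i).erase j, (pulls a k n : ℝ) :=
    (hNn k₀).trans (Finset.single_le_sum (f := fun k => (pulls a k n : ℝ))
      (fun k _ => Nat.cast_nonneg _) hk₀)
  have term : ∀ {N B : ℝ} {θ η e : V}, c * n ≤ N → 0 ≤ B → μ * (‖θ - η‖ - ρ / 8) ≤ B →
      ‖e‖ ≤ c * μ / 4 * n → ⟪θ - η, e⟫ - N * B
        ≤ c * μ * n * (ρ / 8 - 3 / 4 * ‖θ - η‖) := by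
    intro N B θ η e hN hB hle he
    have h1 : ⟪θ - η, e⟫ ≤ ‖θ - η‖ * (c * μ / 4 * n) :=
      (real_inner_le_norm _ _).trans (by gcongr)
    have h2 : c * n * (μ * (‖θ - η‖ - ρ / 8)) ≤ N * B :=
      (mul_le_mul_of_nonneg_left hle (by positivity)).trans (mul_le_mul_of_nonneg_right hN hB)
    linarith
  have t1 := term (hNn j) (fam.bregman_nonneg hfam hη₂ hθ₁) (hB₂' θ₁ hθ₁) ej
  have t2 := term (hNn i) (fam.bregman_nonneg hfam hη₁ hθ₂) (hB₁' θ₂ hθ₂) ei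
  have t3 := term hr (fam.bregman_nonneg hfam hη₂ hθ₂) (hB₂' θ₂ hθ₂) er
  have tri : ρ ≤ ‖θ₂ - η₁‖ + ‖θ₂ - η₂‖ := by
    rw [hρdef, norm_sub_rev θ₂ η₁]
    simpa using norm_add_le (η₁ - θ₂) (θ₂ - η₂)
  have key := fam.logLik_sub_logLik a x n hij η₁ η₂ θ₁ θ₂
  have hq : 0 ≤ c * μ * n := by positivity
  have f1 := mul_le_mul_of_nonneg_left tri hq
  have f2 := mul_nonneg hq (norm_nonneg (θ₁ - η₂))
  nlinarith

theorem setLIntegral_priorDensity_pos (hfam : fam.IsRegular) {τ : V} {n₀ : ℝ}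
    (hprior : ∫⁻ η in fam.Θ, fam.priorWeight τ n₀ η < ∞) {η : V} {r : ℝ} (hr : 0 < r)
    (hsub : Metric.ball η r ⊆ fam.Θ) :
    0 < ∫⁻ θ in Metric.ball η r, fam.priorDensity τ n₀ θ := by
  have hnorm : fam.priorNorm τ n₀ ≠ 0 := ENNReal.inv_ne_zero.2 hprior.ne
  have hmeas : AEMeasurable (fam.priorWeight τ n₀) (volume.restrict (Metric.ball η r)) := by
    unfold priorWeight
    have hA := (fam.continuousOn_logPartition hfam).mono hsub
    refine AEMeasurable.ennreal_ofReal (ContinuousOn.aemeasurable ?_ measurableSet_ball)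
    exact ((by fun_prop : ContinuousOn (fun θ : V => ⟪τ, θ⟫) _).sub (hA.const_smul n₀)).rexp
  refine pos_iff_ne_zero.2 fun h0 => ?_
  rw [lintegral_eq_zero_iff' (f := fam.priorDensity τ n₀) (hmeas.const_mul _)] at h0
  have hF : ∀ᵐ θ ∂(volume.restrict (Metric.ball η r)), False := by
    filter_upwards [h0] with θ hθ
    refine mul_ne_zero hnorm ?_ hθ
    rw [priorWeight, Ne, ENNReal.ofReal_eq_zero, not_le]
    exact Real.exp_pos _
  rw [eventually_false_iff_eq_bot, ae_eq_bot, Measure.restrict_eq_zero] at hF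
  exact (Metric.measure_ball_pos volume η hr).ne' hF

/-- The averaged likelihood of the true hypothesis loses only an arbitrarily small exponential rate
against the likelihood at the true parameters, by restricting the average to small balls. -/
theorem eventually_le_avgLikelihood (hfam : fam.IsRegular) {τ : V} {n₀ : ℝ}
    (hprior : ∫⁻ η in fam.Θ, fam.priorWeight τ n₀ η < ∞) {a : ℕ → Fin K} {x : ℕ → 𝒳}
    (hx : ∀ t, 1 ≤ t → 0 < fam.h (x t))
    {i : Fin K} {η₁ η₂ : V} (hη₁ : η₁ ∈ fam.Θ) (hη₂ : η₂ ∈ fam.Θ)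
    (hY : ∀ k, ∀ ε : ℝ, 0 < ε → ∀ᶠ n : ℕ in atTop,
      ‖fam.armError a x (armParam i η₁ η₂ k) k n‖ ≤ ε * n) {δ : ℝ} (hδ : 0 < δ) :
    ∃ C : ℝ≥0∞, 0 < C ∧ ∀ᶠ n : ℕ in atTop,
      C * ENNReal.ofReal ((∏ t ∈ Finset.Icc 1 n, fam.h (x t))
        * Real.exp (fam.logLik a x n i η₁ η₂ - δ * n)) ≤ fam.avgLikelihood τ n₀ a x n i := by
  -- a common bound for the statistics of single arms
  obtain ⟨M, hM, hYM⟩ : ∃ M : ℝ, 0 < M ∧ ∀ᶠ n : ℕ in atTop, ∀ k, ‖fam.armSum a x k n‖ ≤ M * n := by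
    refine ⟨∑ k, (1 + ‖gradient fam.logPartition (armParam i η₁ η₂ k)‖), ?_, ?_⟩
    · exact Finset.sum_pos (fun _ _ => by positivity) ⟨i, Finset.mem_univ i⟩
    filter_upwards [(eventually_all (ι := Fin K)).2 fun k => hY k 1 one_pos] with n hn k
    have hpn : (pulls a k n : ℝ) ≤ n := Nat.cast_le.2 (pulls_le a k n)
    calc ‖fam.armSum a x k n‖ = ‖fam.armError a x (armParam i η₁ η₂ k) k n
          + (pulls a k n : ℝ) • gradient fam.logPartition (armParam i η₁ η₂ k)‖ := by
          rw [armError, sub_add_cancel]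
      _ ≤ 1 * n + n * ‖gradient fam.logPartition (armParam i η₁ η₂ k)‖ := by
          refine (norm_add_le _ _).trans (add_le_add (hn k) ?_)
          rw [norm_smul, Real.norm_natCast]
          gcongr
      _ = (1 + ‖gradient fam.logPartition (armParam i η₁ η₂ k)‖) * n := by ring
      _ ≤ _ := by
          gcongr
          exact Finset.single_le_sum
            (f := fun k => 1 + ‖gradient fam.logPartition (armParam i η₁ η₂ k)‖)
            (fun _ _ => by positivity) (Finset.mem_univ k)
  have hK0 : (0 : ℝ) < K := by exact_mod_cast i.pos
  set M' := (K + 1) * M with hM'def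
  have hM' : 0 < M' := by positivity
  have hball : ∀ η ∈ fam.Θ, ∃ r, 0 < r ∧ ∀ θ ∈ Metric.ball η r, θ ∈ fam.Θ ∧
      M' * ‖θ - η‖ ≤ δ / 4 ∧ fam.logPartition θ - fam.logPartition η ≤ δ / 4 := by
    intro η hη
    have h1 := fam.isOpen_Θ.mem_nhds hη
    have h2 : ∀ᶠ θ in nhds η, M' * ‖θ - η‖ < δ / 4 := by
      have : ContinuousAt (fun θ : V => M' * ‖θ - η‖) η := by fun_prop
      exact this.eventually_lt_const (by simpa using hδ)
    have h3 : ∀ᶠ θ in nhds η, fam.logPartition θ - fam.logPartition η < δ / 4 := by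
      have : ContinuousAt (fun θ : V => fam.logPartition θ - fam.logPartition η) η :=
        (fam.differentiableAt_logPartition hfam hη).continuousAt.sub continuousAt_const
      exact this.eventually_lt_const (by simpa using hδ)
    obtain ⟨r, hr, h⟩ := Metric.eventually_nhds_iff_ball.1 ((eventually_mem_set.2 h1).and (h2.and h3))
    exact ⟨r, hr, fun θ hθ => ⟨(h θ hθ).1, (h θ hθ).2.1.le, (h θ hθ).2.2.le⟩⟩
  obtain ⟨r₁, hr₁, hb₁⟩ := hball η₁ hη₁
  obtain ⟨r₂, hr₂, hb₂⟩ := hball η₂ hη₂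
  set p := fam.priorDensity τ n₀ with hp
  refine ⟨(∫⁻ θ in Metric.ball η₁ r₁, p θ) * ∫⁻ θ in Metric.ball η₂ r₂, p θ,
    ENNReal.mul_pos
      (fam.setLIntegral_priorDensity_pos hfam hprior hr₁ fun θ hθ => (hb₁ θ hθ).1).ne'
      (fam.setLIntegral_priorDensity_pos hfam hprior hr₂ fun θ hθ => (hb₂ θ hθ).1).ne', ?_⟩
  filter_upwards [hYM] with n hYn
  set H := ∏ t ∈ Finset.Icc 1 n, fam.h (x t) with hH
  have hHpos : 0 < H := Finset.prod_pos fun t ht => hx t (Finset.mem_Icc.1 ht).1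
  have hn : (0 : ℝ) ≤ n := Nat.cast_nonneg n
  have hpn : (pulls a i n : ℝ) ≤ n := Nat.cast_le.2 (pulls_le a i n)
  have hYi : ‖fam.armSum a x i n‖ ≤ M' * n := (hYn i).trans (by
    rw [hM'def]; gcongr; nlinarith)
  have hYr : ‖fam.totalSum a x n - fam.armSum a x i n‖ ≤ M' * n := by
    have h1 : ‖fam.totalSum a x n‖ ≤ K * (M * n) := by
      refine (norm_sum_le_of_le _ fun k _ => hYn k).trans ?_
      simp
    calc _ ≤ _ := norm_sub_le _ _
      _ ≤ K * (M * n) + M * n := add_le_add h1 (hYn i)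
      _ = M' * n := by rw [hM'def]; ring
  have part : ∀ {η θ Y : V} {N : ℝ}, 0 ≤ N → N ≤ n → ‖Y‖ ≤ M' * n → M' * ‖θ - η‖ ≤ δ / 4 →
      fam.logPartition θ - fam.logPartition η ≤ δ / 4 →
      ⟪η, Y⟫ - N * fam.logPartition η - δ / 2 * n ≤ ⟪θ, Y⟫ - N * fam.logPartition θ := by
    intro η θ Y N hN0 hN hY hd hA
    have h1 : ⟪η - θ, Y⟫ ≤ δ / 4 * n := by
      calc ⟪η - θ, Y⟫ ≤ ‖η - θ‖ * ‖Y‖ := real_inner_le_norm _ _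
        _ ≤ ‖η - θ‖ * (M' * n) := by gcongr
        _ = M' * ‖θ - η‖ * n := by rw [norm_sub_rev]; ring
        _ ≤ δ / 4 * n := by gcongr
    have h2 : N * (fam.logPartition θ - fam.logPartition η) ≤ n * (δ / 4) :=
      (mul_le_mul_of_nonneg_left hA hN0).trans (by gcongr)
    rw [inner_sub_left] at h1
    linarith
  have hlik : ∀ θ₁ ∈ Metric.ball η₁ r₁, ∀ θ₂ ∈ Metric.ball η₂ r₂,
      ENNReal.ofReal (H * Real.exp (fam.logLik a x n i η₁ η₂ - δ * n))
        ≤ fam.likelihood a x n i θ₁ θ₂ := by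
    intro θ₁ hθ₁ θ₂ hθ₂
    rw [likelihood_eq]
    refine ENNReal.ofReal_le_ofReal (mul_le_mul_of_nonneg_left (Real.exp_le_exp.2 ?_) hHpos.le)
    have p1 := part (Nat.cast_nonneg (pulls a i n)) hpn hYi (hb₁ θ₁ hθ₁).2.1 (hb₁ θ₁ hθ₁).2.2
    have p2 := part (sub_nonneg.2 hpn) (sub_le_self _ (Nat.cast_nonneg _)) hYr
      (hb₂ θ₂ hθ₂).2.1 (hb₂ θ₂ hθ₂).2.2
    simp only [logLik]
    linarith
  set ℓ := ENNReal.ofReal (H * Real.exp (fam.logLik a x n i η₁ η₂ - δ * n)) with hℓ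
  set q := ∫⁻ θ in Metric.ball η₂ r₂, p θ with hq
  calc (∫⁻ θ in Metric.ball η₁ r₁, p θ) * q * ℓ
      = (∫⁻ θ in Metric.ball η₁ r₁, p θ) * (ℓ * q) := by ring
    _ ≤ ∫⁻ θ in Metric.ball η₁ r₁, p θ * (ℓ * q) := lintegral_mul_const_le _ _
    _ ≤ ∫⁻ θ₁ in Metric.ball η₁ r₁, ∫⁻ θ₂ in fam.Θ, fam.likelihood a x n i θ₁ θ₂ * p θ₁ * p θ₂ := by
        refine setLIntegral_mono' measurableSet_ball fun θ₁ hθ₁ => ?_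
        calc p θ₁ * (ℓ * q) = ℓ * p θ₁ * q := by ring
          _ ≤ ∫⁻ θ₂ in Metric.ball η₂ r₂, ℓ * p θ₁ * p θ₂ := lintegral_const_mul_le _ _
          _ ≤ ∫⁻ θ₂ in Metric.ball η₂ r₂, fam.likelihood a x n i θ₁ θ₂ * p θ₁ * p θ₂ := by
              refine setLIntegral_mono' measurableSet_ball fun θ₂ hθ₂ => ?_
              gcongr
              exact hlik θ₁ hθ₁ θ₂ hθ₂
          _ ≤ _ := lintegral_mono_set fun θ hθ => (hb₂ θ hθ).1
    _ ≤ fam.avgLikelihood τ n₀ a x n i := lintegral_mono_set fun θ hθ => (hb₁ θ hθ).1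

/-- Along a sequence of arms and observations in which every arm is sampled linearly often and the
statistics of the arms obey the law of large numbers, the modified likelihood ratios of the true
hypothesis grow linearly. -/
theorem eventually_mul_le_glr (hK : 3 ≤ K) (hfam : fam.IsRegular) {τ : V} {n₀ : ℝ}
    (hprior : ∫⁻ η in fam.Θ, fam.priorWeight τ n₀ η < ∞) {a : ℕ → Fin K} {x : ℕ → 𝒳}
    (hx : ∀ t, 1 ≤ t → 0 < fam.h (x t))
    {i j : Fin K} (hij : j ≠ i) {η₁ η₂ : V} (hη₁ : η₁ ∈ fam.Θ) (hη₂ : η₂ ∈ fam.Θ) (hη : η₁ ≠ η₂)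
    {c : ℝ} (hc : 0 < c) (hN : ∀ k, ∀ᶠ n : ℕ in atTop, c * n ≤ pulls a k n)
    (hY : ∀ k, ∀ ε : ℝ, 0 < ε → ∀ᶠ n : ℕ in atTop,
      ‖fam.armError a x (armParam i η₁ η₂ k) k n‖ ≤ ε * n) :
    ∃ ρ : ℝ, 0 < ρ ∧ ∀ᶠ n : ℕ in atTop, ((ρ * n : ℝ) : EReal) ≤ fam.glr τ n₀ a x i j n := by
  obtain ⟨δ, hδ, hmax⟩ := fam.eventually_logLik_le hK hfam hij hη₁ hη₂ hη hc hN hY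
  obtain ⟨C, hC, havg⟩ := fam.eventually_le_avgLikelihood hfam hprior hx hη₁ hη₂ hY
    (half_pos hδ)
  have hdecay : ∀ᶠ n : ℕ in atTop, ENNReal.ofReal (Real.exp (-(δ / 4 * n))) ≤ C := by
    have h1 : Tendsto (fun n : ℕ => δ / 4 * (n : ℝ)) atTop atTop :=
      tendsto_natCast_atTop_atTop.const_mul_atTop (by positivity)
    have h2 := ENNReal.tendsto_ofReal (Real.tendsto_exp_neg_atTop_nhds_zero.comp h1)
    rw [ENNReal.ofReal_zero] at h2
    exact (h2.eventually_lt_const hC).mono fun n hn => hn.le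
  refine ⟨δ / 4, by positivity, ?_⟩
  filter_upwards [hmax, havg, hdecay] with n h1 h2 h3
  set H := ∏ t ∈ Finset.Icc 1 n, fam.h (x t) with hH
  have hHpos : 0 < H := Finset.prod_pos fun t ht => hx t (Finset.mem_Icc.1 ht).1
  set l := fam.logLik a x n i η₁ η₂ with hl
  have hub : fam.maxLikelihood a x n j ≤ ENNReal.ofReal (H * Real.exp (l - δ * n)) := by
    refine iSup₂_le fun θ₁ hθ₁ => iSup₂_le fun θ₂ hθ₂ => ?_
    rw [likelihood_eq]
    exact ENNReal.ofReal_le_ofReal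
      (mul_le_mul_of_nonneg_left (Real.exp_le_exp.2 (h1 θ₁ hθ₁ θ₂ hθ₂)) hHpos.le)
  have hpos : 0 < fam.avgLikelihood τ n₀ a x n i :=
    (ENNReal.mul_pos hC.ne' (ENNReal.ofReal_pos.2 (by positivity)).ne').trans_le h2
  have hmain : ENNReal.ofReal (Real.exp (δ / 4 * n)) * fam.maxLikelihood a x n j
      ≤ fam.avgLikelihood τ n₀ a x n i := by
    calc _ ≤ ENNReal.ofReal (Real.exp (δ / 4 * n)) * ENNReal.ofReal (H * Real.exp (l - δ * n)) := by
          gcongr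
      _ = ENNReal.ofReal (Real.exp (-(δ / 4 * n)))
          * ENNReal.ofReal (H * Real.exp (l - δ / 2 * n)) := by
          rw [← ENNReal.ofReal_mul (Real.exp_pos _).le, ← ENNReal.ofReal_mul (Real.exp_pos _).le,
            mul_left_comm, mul_left_comm _ H, ← Real.exp_add, ← Real.exp_add]
          ring_nf
      _ ≤ C * ENNReal.ofReal (H * Real.exp (l - δ / 2 * n)) := by gcongr
      _ ≤ _ := h2
  have hratio : ENNReal.ofReal (Real.exp (δ / 4 * n))
      ≤ fam.avgLikelihood τ n₀ a x n i / fam.maxLikelihood a x n j :=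
    (ENNReal.le_div_iff_mul_le (Or.inr hpos.ne')
      (Or.inl (hub.trans_lt ENNReal.ofReal_lt_top).ne)).2 hmain
  have := ENNReal.log_monotone hratio
  rwa [ENNReal.log_ofReal_of_pos (Real.exp_pos _), Real.log_exp] at this

end ExpFamily

/-! ### Sampling rates and the law of large numbers along a run -/

section Information

variable {Ω 𝒳 : Type*} [MeasurableSpace 𝒳] {K : ℕ}
  {A : ℕ → Ω → Fin K} {X : ℕ → Ω → 𝒳} {I : ℕ → Ω → Fin K} {U : ℕ → Ω → Bool}

theorem infoSigma_mono {p q r s p' q' r' s' : ℕ} (hp : p ≤ p') (hq : q ≤ q') (hr : r ≤ r')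
    (hs : s ≤ s') : infoSigma A X I U p q r s ≤ infoSigma A X I U p' q' r' s' := by
  refine sup_le_sup (sup_le_sup (sup_le_sup ?_ ?_) ?_) ?_ <;>
  exact biSup_mono fun t ht => by simp only [Finset.mem_Icc] at ht ⊢; omega

theorem infoSigma_le {m0 : MeasurableSpace Ω} (hA : ∀ n, Measurable (A n)) (hX : ∀ n, Measurable (X n))
    (hI : ∀ n, Measurable (I n)) (hU : ∀ n, Measurable (U n)) (p q r s : ℕ) :
    infoSigma A X I U p q r s ≤ m0 :=
  sup_le (sup_le (sup_le (iSup₂_le fun t _ => (hA t).comap_le)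
    (iSup₂_le fun t _ => (hX t).comap_le)) (iSup₂_le fun t _ => (hI t).comap_le))
    (iSup₂_le fun t _ => (hU t).comap_le)

theorem measurable_arm_infoSigma {p q r s t : ℕ} (h1 : 1 ≤ t) (h2 : t ≤ p) :
    Measurable[infoSigma A X I U p q r s] (A t) :=
  Measurable.of_comap_le <| le_sup_of_le_left <| le_sup_of_le_left <| le_sup_of_le_left <|
    le_biSup (fun t => MeasurableSpace.comap (A t) inferInstance) (Finset.mem_Icc.2 ⟨h1, h2⟩)

theorem measurable_observation_infoSigma {p q r s t : ℕ} (h1 : 1 ≤ t) (h2 : t ≤ q) :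
    Measurable[infoSigma A X I U p q r s] (X t) :=
  Measurable.of_comap_le <| le_sup_of_le_left <| le_sup_of_le_left <| le_sup_of_le_right <|
    le_biSup (fun t => MeasurableSpace.comap (X t) inferInstance) (Finset.mem_Icc.2 ⟨h1, h2⟩)

theorem measurable_coin_infoSigma {p q r s t : ℕ} (h1 : 2 ≤ t) (h2 : t ≤ s) :
    Measurable[infoSigma A X I U p q r s] (U t) :=
  Measurable.of_comap_le <| le_sup_of_le_right <|
    le_biSup (fun t => MeasurableSpace.comap (U t) inferInstance) (Finset.mem_Icc.2 ⟨h1, h2⟩)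

end Information

namespace ExpFamily

variable {𝒳 : Type*} [MeasurableSpace 𝒳] {K d : ℕ} (fam : ExpFamily 𝒳 d)

theorem pulls_succ (a : ℕ → Fin K) (k : Fin K) (n : ℕ) :
    pulls a k (n + 1) = pulls a k n + if a (n + 1) = k then 1 else 0 := by
  rw [pulls, pulls, ← Finset.insert_Icc_right_eq_Icc_add_one (by omega), Finset.filter_insert]
  split_ifs with h
  · rw [Finset.card_insert_of_notMem (by simp)]
  · rfl

theorem armSum_succ (a : ℕ → Fin K) (x : ℕ → 𝒳) (k : Fin K) (n : ℕ) :
    fam.armSum a x k (n + 1)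
      = fam.armSum a x k n + if a (n + 1) = k then fam.T (x (n + 1)) else 0 := by
  rw [armSum, armSum, Finset.sum_Icc_succ_top (by omega)]

theorem sum_logLikelihoodRatio (a : ℕ → Fin K) (x : ℕ → 𝒳) (k : Fin K)
    (s : EuclideanSpace ℝ (Fin d)) (u : ℝ) (n : ℕ) :
    ∑ t ∈ Finset.range n, (if a (t + 1) = k then ⟪s, fam.T (x (t + 1))⟫ - u else 0)
      = ⟪s, fam.armSum a x k n⟫ - pulls a k n * u := by
  induction n with
  | zero => simp [armSum, pulls]
  | succ n ih =>
    rw [Finset.sum_range_succ, ih, armSum_succ, pulls_succ, inner_add_right]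
    split_ifs
    · push_cast; ring
    · simp

theorem sum_le_pulls (a : ℕ → Fin K) (k : Fin K) (p : ℕ → Prop) [DecidablePred p] (n : ℕ) :
    ∑ t ∈ Finset.range n, (if p t ∧ a (t + 2) = k then (1 : ℝ) else 0)
      ≤ pulls a k (n + 1) := by
  induction n with
  | zero => simp
  | succ n ih =>
    rw [Finset.sum_range_succ, pulls_succ, Nat.cast_add]
    refine add_le_add ih ?_
    by_cases h : a (n + 2) = k
    · simp only [h, and_true, if_true]
      split_ifs <;> simp
    · simp [h]

/-- By differentiability, `(A(η + δ v) - A(η)) / δ` is at most the directional derivative of `A`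
up to `ε`, for some small `δ > 0`. -/
theorem exists_logPartition_add_le (hfam : fam.IsRegular) {η : EuclideanSpace ℝ (Fin d)}
    (hη : η ∈ fam.Θ) (v : EuclideanSpace ℝ (Fin d)) {ε : ℝ} (hε : 0 < ε) :
    ∃ δ, 0 < δ ∧ η + δ • v ∈ fam.Θ ∧ fam.logPartition (η + δ • v) - fam.logPartition η
      ≤ δ * (⟪v, gradient fam.logPartition η⟫ + ε) := by
  let ℓ : ℝ → EuclideanSpace ℝ (Fin d) := fun t => η + t • v
  have h1 : HasDerivAt ℓ v 0 := by
    simpa [ℓ] using ((hasDerivAt_id (0 : ℝ)).smul_const v).const_add η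
  have h2 : HasFDerivAt fam.logPartition (fderiv ℝ fam.logPartition η) (ℓ 0) := by
    simpa [ℓ] using (fam.differentiableAt_logPartition hfam hη).hasFDerivAt
  have h3 := h2.comp_hasDerivAt 0 h1
  rw [← inner_gradient_left, real_inner_comm, hasDerivAt_iff_tendsto_slope] at h3
  have h4 : Tendsto (slope (fam.logPartition ∘ ℓ) 0) (nhdsWithin 0 (Set.Ioi 0))
      (nhds ⟪v, gradient fam.logPartition η⟫) :=
    h3.mono_left (nhdsWithin_mono _ fun t ht => (ne_of_gt ht : t ≠ 0))
  have h5 : ∀ᶠ t in nhdsWithin (0 : ℝ) (Set.Ioi 0), ℓ t ∈ fam.Θ := by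
    refine (h1.continuousAt.eventually_mem ?_).filter_mono nhdsWithin_le_nhds
    exact fam.isOpen_Θ.mem_nhds (by simpa [ℓ] using hη)
  obtain ⟨δ, hδ, hδm, hδl⟩ := (((eventually_mem_nhdsWithin).and
    (h5.and (h4.eventually_lt_const (lt_add_of_pos_right _ hε)))).exists)
  have hδ0 : 0 < δ := hδ
  refine ⟨δ, hδ0, hδm, ?_⟩
  simp only [slope_def_field, Function.comp_apply, ℓ, zero_smul, add_zero, sub_zero,
    div_lt_iff₀ hδ0] at hδl
  linarith

end ExpFamily

namespace SluggishPolicy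

variable {𝒳 : Type*} [MeasurableSpace 𝒳] {K d : ℕ}

theorem exists_le_samplingDist {pol : SluggishPolicy K d} {fam : ExpFamily 𝒳 d}
    (hpol : pol.IsValid fam) (hsamp : pol.SamplesAllArms fam) :
    ∃ c : ℝ, 0 < c ∧ c ≤ 1 ∧ ∀ (a : ℕ → Fin K) (x : ℕ → 𝒳) (k : Fin K) (n : ℕ) (j : Fin K),
      c ≤ pol.samplingDist fam a x k n j := by
  obtain ⟨c, hc, hc1, hlam⟩ := hsamp
  rcases isEmpty_or_nonempty (Fin K) with hE | hE
  · exact ⟨1, one_pos, le_rfl, fun _ _ k => (IsEmpty.false k).elim⟩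
  obtain ⟨j₀, hj₀⟩ := Finite.exists_min pol.fallback
  refine ⟨min c (pol.fallback j₀), lt_min hc (hpol.fallback_pos j₀),
    (min_le_left _ _).trans hc1.le, fun a x k n j => ?_⟩
  rw [samplingDist]
  split_ifs with h
  · exact (min_le_left _ _).trans (hlam k _ (Function.invFunOn_mem h.2.2.1) _
      (Function.invFunOn_mem h.2.2.2.1) h.2.2.2.2 j)
  · exact (min_le_right _ _).trans (hj₀ j)

end SluggishPolicy

theorem armParam_mem {K d : ℕ} {i : Fin K} {η₁ η₂ : EuclideanSpace ℝ (Fin d)}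
    {Θ : Set (EuclideanSpace ℝ (Fin d))} (hη₁ : η₁ ∈ Θ) (hη₂ : η₂ ∈ Θ) (k : Fin K) :
    armParam i η₁ η₂ k ∈ Θ := by
  unfold armParam
  split_ifs <;> assumption

theorem norm_le_of_forall_inner_le {d : ℕ} {v : EuclideanSpace ℝ (Fin d)} {r : ℝ}
    (h : ∀ l, |⟪EuclideanSpace.basisFun (Fin d) ℝ l, v⟫| ≤ r) : ‖v‖ ≤ d * r := by
  rw [← (EuclideanSpace.basisFun (Fin d) ℝ).sum_repr' v]
  refine (norm_sum_le_of_le (f := fun l => ⟪EuclideanSpace.basisFun (Fin d) ℝ l, v⟫ •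
    EuclideanSpace.basisFun (Fin d) ℝ l) (n := fun _ => r) _ fun l _ => ?_).trans ?_
  · rw [norm_smul, OrthonormalBasis.norm_eq_one, mul_one]
    exact h l
  · simp

namespace IsRun

variable {Ω 𝒳 : Type*} [MeasurableSpace Ω] [MeasurableSpace 𝒳] {K d : ℕ}
  {P : Measure Ω} {fam : ExpFamily 𝒳 d} {pol : SluggishPolicy K d}
  {halt : EReal → Prop} {i : Fin K} {η₁ η₂ : EuclideanSpace ℝ (Fin d)}
  {A : ℕ → Ω → Fin K} {X : ℕ → Ω → 𝒳} {I : ℕ → Ω → Fin K} {U : ℕ → Ω → Bool}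

theorem infoSigma_le (hrun : IsRun P fam pol halt i η₁ η₂ A X I U) (p q r s : ℕ) :
    infoSigma A X I U p q r s ≤ ‹MeasurableSpace Ω› :=
  _root_.infoSigma_le hrun.measurable_A hrun.measurable_X hrun.measurable_I hrun.measurable_U p q r s

variable [IsProbabilityMeasure P]

/-- As long as the policy is active, every arm is sampled linearly often: successful coins have a
positive frequency, and after a successful coin every arm has a probability bounded below. -/
theorem ae_eventually_le_pulls (hrun : IsRun P fam pol halt i η₁ η₂ A X I U)
    (hpol : pol.IsValid fam) (hsamp : pol.SamplesAllArms fam) :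
    ∃ c : ℝ, 0 < c ∧ ∀ᵐ ω ∂P, (∀ n, IsActive fam pol halt A X I n ω) →
      ∀ k, ∀ᶠ n : ℕ in atTop, c * n ≤ ExpFamily.pulls (fun t => A t ω) k n := by
  classical
  obtain ⟨c, hc, hc1, hle⟩ := pol.exists_le_samplingDist hpol hsamp
  set β := bernoulliRate pol.γ with hβdef
  have hβ : 0 < β := bernoulliRate_pos hpol.γ_pos hpol.γ_le_one
  set β' := bernoulliRate c with hβ'def
  have hβ' : 0 < β' := bernoulliRate_pos hc hc1
  -- the index `n` stands for round `n + 1`, as the first coin is `U_2`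
  have hcoin := ae_eventually_count_ge (P := P) (c := pol.γ) (ε := β / 2)
    (F := fun n => infoSigma A X I U (n + 1) (n + 1) (n + 1) (n + 1))
    (fun n n' h => infoSigma_mono (by omega) (by omega) (by omega) (by omega))
    (fun n => hrun.infoSigma_le _ _ _ _) (E := fun n => U (n + 2) ⁻¹' {true})
    (V := fun _ => Set.univ)
    (fun n => measurable_coin_infoSigma (by omega) (by omega) (measurableSet_singleton _))
    (fun n => MeasurableSet.univ) (S := fun n => IsActive fam pol halt A X I (n + 1))
    hpol.γ_le_one
    (fun n => (hrun.coin (n + 1) (by omega)).mono fun ω hω hS _ => (hω hS).ge) (by positivity)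
  have harm : ∀ k : Fin K, _ := fun k =>
    ae_eventually_count_ge (P := P) (c := c) (ε := β' * β / 4)
    (F := fun n => infoSigma A X I U (n + 1) (n + 1) (n + 1) (n + 2))
    (fun n n' h => infoSigma_mono (by omega) (by omega) (by omega) (by omega))
    (fun n => hrun.infoSigma_le _ _ _ _) (E := fun n => A (n + 2) ⁻¹' {k})
    (V := fun n => U (n + 2) ⁻¹' {true})
    (fun n => measurable_arm_infoSigma (by omega) (by omega) (measurableSet_singleton _))
    (fun n => measurable_coin_infoSigma (by omega) (by omega) (measurableSet_singleton _))
    (S := fun n => IsActive fam pol halt A X I (n + 1)) hc1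
    (fun n => (hrun.arm (n + 1) (by omega) k).mono fun ω hω hS hV => by
      rw [hω hS, if_pos (by simpa using hV)]
      exact hle _ _ _ _ _) (by positivity)
  refine ⟨β' * β / 8, by positivity, ?_⟩
  filter_upwards [hcoin, ae_all_iff.2 harm] with ω h1 h2 hS k
  have key : ∀ᶠ n : ℕ in atTop,
      β' * β / 4 * n ≤ ExpFamily.pulls (fun t => A t ω) k (n + 1) := by
    filter_upwards [h1 fun n => hS _, h2 k fun n => hS _] with n g1 g2
    have g3 := ExpFamily.sum_le_pulls (fun t => A t ω) k (fun t => U (t + 2) ω = true) n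
    simp only [Set.mem_univ, if_true, Set.mem_inter_iff, Set.mem_preimage,
      Set.mem_singleton_iff, Set.univ_inter, Finset.sum_const, Finset.card_range, nsmul_eq_mul,
      mul_one] at g1 g2
    have g4 := mul_le_mul_of_nonneg_left g1 hβ'.le
    linarith
  obtain ⟨N, hN⟩ := eventually_atTop.1 key
  refine eventually_atTop.2 ⟨N + 2, fun n hn => ?_⟩
  obtain ⟨m, rfl⟩ : ∃ m, n = m + 1 := ⟨n - 1, by omega⟩
  refine le_trans ?_ (hN m (by omega))
  have hm : (1 : ℝ) ≤ m := by exact_mod_cast (by omega : 1 ≤ m)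
  push_cast
  nlinarith [mul_pos hβ' hβ]

theorem ae_h_pos (hrun : IsRun P fam pol halt i η₁ η₂ A X I U) :
    ∀ᵐ ω ∂P, (∀ n, IsActive fam pol halt A X I n ω) → ∀ t, 1 ≤ t → 0 < fam.h (X t ω) := by
  have hm : MeasurableSet {x | fam.h x = 0} := fam.measurable_h (measurableSet_singleton 0)
  have : ∀ t, ∀ᵐ ω ∂P, 1 ≤ t → IsActive fam pol halt A X I (t - 1) ω →
      ω ∉ X t ⁻¹' {x | fam.h x = 0} := by
    intro t
    by_cases ht : 1 ≤ t
    · have h0 := ae_notMem_of_condProb_eq_zero (P := P) (hrun.infoSigma_le _ _ _ _)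
        (hrun.measurable_X t hm) (S := IsActive fam pol halt A X I (t - 1))
        ((hrun.observation t ht _ hm).mono fun ω hω hS => by
          rw [hω hS, measureReal_def, fam.law_setOf_h_eq_zero, ENNReal.toReal_zero])
      exact h0.mono fun ω hω _ => hω
    · exact Eventually.of_forall fun ω h => absurd h ht
  filter_upwards [ae_all_iff.2 this] with ω hω hS t ht
  exact (fam.h_nonneg _).lt_of_ne' (hω t ht (hS _))

theorem ae_mem_leaders (hrun : IsRun P fam pol halt i η₁ η₂ A X I U) :
    ∀ᵐ ω ∂P, (∀ n, IsActive fam pol halt A X I n ω) → ∀ n, 1 ≤ n →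
      I n ω ∈ fam.leaders pol.τ pol.n₀ (fun t => A t ω) (fun t => X t ω) n := by
  have : ∀ n, ∀ k : Fin K, ∀ᵐ ω ∂P, 1 ≤ n → (IsActive fam pol halt A X I (n - 1) ω ∧
      k ∉ fam.leaders pol.τ pol.n₀ (fun t => A t ω) (fun t => X t ω) n) →
      ω ∉ I n ⁻¹' {k} := by
    intro n k
    by_cases hn : 1 ≤ n
    · have h0 := ae_notMem_of_condProb_eq_zero (P := P) (hrun.infoSigma_le _ _ _ _)
        (hrun.measurable_I n (measurableSet_singleton k))
        (S := fun ω => IsActive fam pol halt A X I (n - 1) ω ∧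
          k ∉ fam.leaders pol.τ pol.n₀ (fun t => A t ω) (fun t => X t ω) n)
        ((hrun.leader n hn k).mono fun ω hω hS => by rw [hω hS.1, if_neg hS.2])
      exact h0.mono fun ω hω _ => hω
    · exact Eventually.of_forall fun ω h => absurd h hn
  filter_upwards [ae_all_iff.2 fun n => ae_all_iff.2 (this n)] with ω hω hS n hn
  by_contra hmem
  exact hω n (I n ω) hn ⟨hS _, hmem⟩ rfl

/-- The likelihood ratio of the parameters `η + s` and `η` of an arm is an exponential martingale,
so that it eventually grows at most subexponentially. -/
theorem ae_eventually_inner_armSum_le (hrun : IsRun P fam pol halt i η₁ η₂ A X I U)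
    (hη₁ : η₁ ∈ fam.Θ) (hη₂ : η₂ ∈ fam.Θ) (k : Fin K) {s : EuclideanSpace ℝ (Fin d)}
    (hs : armParam i η₁ η₂ k + s ∈ fam.Θ) {ε : ℝ} (hε : 0 < ε) :
    ∀ᵐ ω ∂P, (∀ n, IsActive fam pol halt A X I n ω) → ∀ᶠ n : ℕ in atTop,
      ⟪s, fam.armSum (fun t => A t ω) (fun t => X t ω) k n⟫
        - ExpFamily.pulls (fun t => A t ω) k n * (fam.logPartition (armParam i η₁ η₂ k + s)
          - fam.logPartition (armParam i η₁ η₂ k)) ≤ ε * n := by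
  set u := fam.logPartition (armParam i η₁ η₂ k + s) - fam.logPartition (armParam i η₁ η₂ k)
    with hu
  have : ∀ k, IsProbabilityMeasure (fam.law (armParam i η₁ η₂ k)) := fun k =>
    fam.isProbabilityMeasure_law (armParam_mem hη₁ hη₂ k)
  have hφ : Measurable fun x => ENNReal.ofReal (Real.exp (⟪s, fam.T x⟫ - u)) :=
    (Real.measurable_exp.comp ((fam.measurable_inner_T s).sub_const _)).ennreal_ofReal
  have key := ae_eventually_sum_le (P := P)
    (F := fun n => infoSigma A X I U (n + 1) n n (n + 1))
    (fun n n' h => infoSigma_mono (by omega) (by omega) (by omega) (by omega))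
    (fun n => hrun.infoSigma_le _ _ _ _) (S := fun n => IsActive fam pol halt A X I n)
    (w := fun n ω => if A (n + 1) ω = k then ⟪s, fam.T (X (n + 1) ω)⟫ - u else 0) ?_ ?_ hε
  · filter_upwards [key] with ω hω hS
    filter_upwards [hω hS] with n hn
    rwa [← fam.sum_logLikelihoodRatio (fun t => A t ω) (fun t => X t ω)]
  · intro n
    refine Measurable.ite ?_ ?_ measurable_const
    · exact measurable_arm_infoSigma (t := n + 1) (by omega) (by omega) (measurableSet_singleton k)
    · exact ((fam.measurable_inner_T s).comp
        (measurable_observation_infoSigma (by omega) (by omega))).sub_const _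
  · intro n
    have hAm : Measurable[infoSigma A X I U (n + 1) n n (n + 1)] (A (n + 1)) :=
      measurable_arm_infoSigma (by omega) le_rfl
    have hle := hrun.infoSigma_le (n + 1) n n (n + 1)
    obtain ⟨D, hDm, hDS, hDC⟩ := exists_setLIntegral_comp_eq_of_condProb (P := P) hle
      (hrun.measurable_X (n + 1)) hAm (Q := fun k => fam.law (armParam i η₁ η₂ k))
      (S := IsActive fam pol halt A X I n)
      (fun B hB => hrun.observation (n + 1) (by omega) B hB) hφ
    refine ⟨D, hDm, hDS, fun C hC hCD => ?_⟩
    have hAk : MeasurableSet[infoSigma A X I U (n + 1) n n (n + 1)] (A (n + 1) ⁻¹' {k}) :=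
      hAm (measurableSet_singleton k)
    rw [← lintegral_inter_add_sdiff _ C (hle _ hAk), ← measure_inter_add_sdiff C (hle _ hAk)]
    refine add_le_add (le_of_eq ?_) (le_of_eq ?_)
    · rw [setLIntegral_congr_fun (g := fun ω => ENNReal.ofReal
        (Real.exp (⟪s, fam.T (X (n + 1) ω)⟫ - u))) ((hle _ hC).inter (hle _ hAk)),
        hDC k _ (hC.inter hAk) (Set.inter_subset_left.trans hCD) fun ω hω => hω.2,
        fam.lintegral_exp_inner_law hs, one_mul]
      intro ω hω
      have : A (n + 1) ω = k := hω.2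
      simp [this]
    · rw [setLIntegral_congr_fun (g := fun _ => 1) ((hle _ hC).diff (hle _ hAk)),
        setLIntegral_const, one_mul]
      intro ω hω
      have : A (n + 1) ω ≠ k := hω.2
      simp [this]

/-- Strong law of large numbers for the sufficient statistics of the arms, from exponential
martingales in the coordinate directions. -/
theorem ae_eventually_norm_armError_le (hrun : IsRun P fam pol halt i η₁ η₂ A X I U)
    (hfam : fam.IsRegular) (hη₁ : η₁ ∈ fam.Θ) (hη₂ : η₂ ∈ fam.Θ) :
    ∀ᵐ ω ∂P, (∀ n, IsActive fam pol halt A X I n ω) → ∀ k, ∀ ε : ℝ, 0 < ε →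
      ∀ᶠ n : ℕ in atTop,
        ‖fam.armError (fun t => A t ω) (fun t => X t ω) (armParam i η₁ η₂ k) k n‖ ≤ ε * n := by
  have dir : ∀ (k : Fin K) (v : EuclideanSpace ℝ (Fin d)) (ε : ℝ), 0 < ε →
      ∀ᵐ ω ∂P, (∀ n, IsActive fam pol halt A X I n ω) → ∀ᶠ n : ℕ in atTop,
        ⟪v, fam.armError (fun t => A t ω) (fun t => X t ω) (armParam i η₁ η₂ k) k n⟫
          ≤ ε * n := by
    intro k v ε hε
    obtain ⟨δ, hδ, hmem, hle⟩ := fam.exists_logPartition_add_le hfam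
      (armParam_mem hη₁ hη₂ k) v (half_pos hε)
    filter_upwards [hrun.ae_eventually_inner_armSum_le hη₁ hη₂ k hmem
      (mul_pos hδ (half_pos hε))] with ω hω hS
    filter_upwards [hω hS] with n hn
    set p := ExpFamily.pulls (fun t => A t ω) k n with hp
    have hpn : (p : ℝ) ≤ n := Nat.cast_le.2 (ExpFamily.pulls_le _ k n)
    have h1 := mul_le_mul_of_nonneg_left hle (Nat.cast_nonneg (α := ℝ) p)
    rw [real_inner_smul_left] at hn
    rw [ExpFamily.armError, inner_sub_right, inner_smul_right]
    have h2 : δ * (p * (ε / 2)) ≤ δ * (n * (ε / 2)) := by gcongr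
    refine le_of_mul_le_mul_left ?_ hδ
    linarith
  have dir' : ∀ᵐ ω ∂P, ∀ (k : Fin K) (l : Fin d) (m : ℕ),
      (∀ n, IsActive fam pol halt A X I n ω) → ∀ᶠ n : ℕ in atTop,
        |⟪EuclideanSpace.basisFun (Fin d) ℝ l,
          fam.armError (fun t => A t ω) (fun t => X t ω) (armParam i η₁ η₂ k) k n⟫|
          ≤ 1 / ((m : ℝ) + 1) * n := by
    refine ae_all_iff.2 fun k => ae_all_iff.2 fun l => ae_all_iff.2 fun m => ?_
    filter_upwards [dir k (EuclideanSpace.basisFun (Fin d) ℝ l) (1 / ((m : ℝ) + 1))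
      (by positivity), dir k (-EuclideanSpace.basisFun (Fin d) ℝ l) (1 / ((m : ℝ) + 1))
      (by positivity)] with ω h1 h2 hS
    filter_upwards [h1 hS, h2 hS] with n g1 g2
    rw [inner_neg_left] at g2
    exact abs_le'.2 ⟨g1, g2⟩
  filter_upwards [dir'] with ω hω hS k ε hε
  obtain ⟨m, hm⟩ := exists_nat_one_div_lt (show 0 < ε / (d + 1) by positivity)
  filter_upwards [(eventually_all (ι := Fin d)).2 fun l => hω k l m hS] with n hn
  refine (norm_le_of_forall_inner_le hn).trans ?_
  rw [lt_div_iff₀ (by positivity)] at hm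
  have hm0 : 0 < 1 / ((m : ℝ) + 1) := by positivity
  rw [← mul_assoc]
  gcongr
  linarith

/-- On the event that the policy never stops, the modified likelihood ratios of the true hypothesis
grow linearly. -/
theorem ae_eventually_mul_le_glr (hrun : IsRun P fam pol halt i η₁ η₂ A X I U) (hK : 3 ≤ K)
    (hfam : fam.IsRegular) (hpol : pol.IsValid fam) (hsamp : pol.SamplesAllArms fam)
    (hη₁ : η₁ ∈ fam.Θ) (hη₂ : η₂ ∈ fam.Θ) (hη : η₁ ≠ η₂) :
    ∀ᵐ ω ∂P, (∀ n, IsActive fam pol halt A X I n ω) → ∀ j, j ≠ i →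
      ∃ ρ : ℝ, 0 < ρ ∧ ∀ᶠ n : ℕ in atTop,
        ((ρ * n : ℝ) : EReal) ≤ fam.glr pol.τ pol.n₀ (fun t => A t ω) (fun t => X t ω) i j n := by
  obtain ⟨c, hc, hpulls⟩ := hrun.ae_eventually_le_pulls hpol hsamp
  filter_upwards [hpulls, hrun.ae_h_pos, hrun.ae_eventually_norm_armError_le hfam hη₁ hη₂]
    with ω h1 h2 h3 hS j hj
  exact fam.eventually_mul_le_glr hK hfam hpol.proper_prior (h2 hS) hj hη₁ hη₂ hη hc (h1 hS)
    (h3 hS)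

end IsRun

end

/-! ### Stopping and the growth rate -/

theorem proposition3 {Ω 𝒳 : Type*} [MeasurableSpace Ω] [MeasurableSpace 𝒳] {K d : ℕ}
    (hK : 3 ≤ K)
    (P : Measure Ω) [IsProbabilityMeasure P]
    (fam : ExpFamily 𝒳 d) (hfam : fam.IsRegular)
    (pol : SluggishPolicy K d) (hpol : pol.IsValid fam) (hsamp : pol.SamplesAllArms fam)
    (i : Fin K) (η₁ η₂ : EuclideanSpace ℝ (Fin d))
    (hη₁ : η₁ ∈ fam.Θ) (hη₂ : η₂ ∈ fam.Θ) (hη : η₁ ≠ η₂)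
    (L : ℝ) (hL : 1 < L)
    (A : ℕ → Ω → Fin K) (X : ℕ → Ω → 𝒳) (I : ℕ → Ω → Fin K) (U : ℕ → Ω → Bool) :
    (IsRun P fam pol (thresholdStop K L) i η₁ η₂ A X I U →
      ∀ᵐ ω ∂P, stoppingTime fam pol (thresholdStop K L) A X I ω < ⊤) ∧
    (IsRun P fam pol neverStop i η₁ η₂ A X I U →
      ∀ᵐ ω ∂P, ∀ j, j ≠ i →
        0 < liminf (fun n : ℕ =>
          fam.glr pol.τ pol.n₀ (fun t => A t ω) (fun t => X t ω) i j n / (n : EReal)) atTop) := by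
  refine ⟨fun hrun => ?_, fun hrun => ?_⟩
  · filter_upwards [hrun.ae_mem_leaders,
      hrun.ae_eventually_mul_le_glr hK hfam hpol hsamp hη₁ hη₂ hη] with ω hlead hglr
    have hhalt : ∃ n, 1 ≤ n ∧ thresholdStop K L (leaderStat fam pol A X I n ω) := by
      by_contra! hnot
      have hS : ∀ n, IsActive fam pol (thresholdStop K L) A X I n ω := fun n m hm _ => hnot m hm
      have hev : ∀ᶠ n : ℕ in atTop, ∀ j, j ≠ i → ((Real.log (((K : ℝ) - 1) * L) : ℝ) : EReal)
          ≤ fam.glr pol.τ pol.n₀ (fun t => A t ω) (fun t => X t ω) i j n := by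
        refine (eventually_all (ι := Fin K)).2 fun j => ?_
        by_cases hj : j = i
        · exact Eventually.of_forall fun n h => absurd hj h
        obtain ⟨ρ, hρ, h⟩ := hglr hS j hj
        have hlarge : ∀ᶠ n : ℕ in atTop, Real.log (((K : ℝ) - 1) * L) ≤ ρ * n :=
          (tendsto_natCast_atTop_atTop.const_mul_atTop hρ).eventually_ge_atTop _
        filter_upwards [h, hlarge] with n h1 h2 _
        exact (EReal.coe_le_coe_iff.2 h2).trans h1
      obtain ⟨n, hn, hn1⟩ := (hev.and (eventually_ge_atTop 1)).exists
      refine hnot n hn1 ?_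
      have hmax := (Finset.mem_filter.1 (hlead hS n hn1)).2 i
      exact (le_iInf₂ hn : _ ≤ fam.minGlr pol.τ pol.n₀ _ _ i n).trans hmax
    obtain ⟨n, hn1, hn⟩ := hhalt
    exact (iInf_le_of_le n (iInf₂_le hn1 hn)).trans_lt (ENat.natCast_lt_top n)
  · filter_upwards [hrun.ae_eventually_mul_le_glr hK hfam hpol hsamp hη₁ hη₂ hη] with ω hglr j hj
    obtain ⟨ρ, hρ, h⟩ := hglr (fun _ _ _ _ h => h) j hj
    refine (EReal.coe_pos.2 hρ).trans_le (le_liminf_of_le (by isBoundedDefault) ?_)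
    filter_upwards [h, eventually_ge_atTop 1] with n h1 hn
    have hn0 : (0 : EReal) < n := by exact_mod_cast hn
    rw [EReal.le_div_iff_mul_le hn0 (EReal.natCast_ne_top n)]
    exact_mod_cast h1
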